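/- Let $G,H$ be countable groups which are locally finite-by-abelian, i.e. every finitely generated subgroup $K$ of $G$ (respectively of $H$) has a finite normal subgroup $N$ such that $K/N$ is abelian. Endow $G$ and $H$ with arbitrary proper left-invariant metrics (proper means that all closed balls are compact). Then the metric spaces $G$ and $H$ are coarsely equivalent if and only if $\mathrm{asdim}(G)=\mathrm{asdim}(H)$ and either $G$ and $H$ are both finitely generated or neither of them is finitely generated. Here a map $f:X\to Y$ of metric spaces is bornologous if for every $\delta<\infty$ there is $C<\infty$ such that $d(x,x')\le\delta$ implies $d(f(x),f(x'))\le C$ for all $x,x'\in X$. Spaces $X,Y$ are coarsely equivalent if there are bornologous maps $f:X\to Y$, $g:Y\to X$ and a real constant $K$ with $d(g(f(x)),x)\le K$ for all $x\in X$ and $d(f(g(y)),y)\le K$ for all $y\in Y$. The asymptotic dimension $\mathrm{asdim}(X)\in\{0,1,2,\dots\}\cup\{\infty\}$ is the smallest $n\ge 0$ such that for every $D\ge 0$ there is a cover $\mathcal U=\mathcal U_0\cup\dots\cup\mathcal U_n$ of $X$ by sets of uniformly bounded diameter in which any two distinct members $U,V$ of the same subfamily $\mathcal U_i$ satisfy $d(u,v)\ge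 D$ for all $u\in U$, $v\in V$; it is $\infty$ if there is no such $n$. -/

import Mathlib

/-- A map between metric spaces is bornologous if its continuity modulus is finite at every
`δ`: points at distance at most `δ` have images at distance bounded in terms of `δ` only. -/
def IsBornologous {X Y : Type*} [MetricSpace X] [MetricSpace Y] (f : X → Y) : Prop :=
  ∀ δ : ℝ, ∃ C : ℝ, ∀ x y : X, dist x y ≤ δ → dist (f x) (f y) ≤ C

/-- Two metric spaces are coarsely equivalent if there are bornologous maps in both directions
whose two composites are at finite distance from the identity maps. -/
def CoarselyEquivalent (X Y : Type*) [MetricSpace X] [MetricSpace Y] : Prop :=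
  ∃ (f : X → Y) (g : Y → X) (K : ℝ), IsBornologous f ∧ IsBornologous g ∧
    (∀ x : X, dist (g (f x)) x ≤ K) ∧ ∀ y : Y, dist (f (g y)) y ≤ K

/-- A family of sets is `D`-discrete if any two distinct members are at distance at least `D`
(the infimum over an empty set of pairs being infinite). -/
def IsDiscreteFamily {X : Type*} [MetricSpace X] (D : ℝ) (𝓤 : Set (Set X)) : Prop :=
  ∀ U ∈ 𝓤, ∀ V ∈ 𝓤, U ≠ V → ∀ u ∈ U, ∀ v ∈ V, D ≤ dist u v

/-- `asdim X ≤ n`: for every `D ≥ 0` there is a cover of `X` by sets of uniformly bounded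
diameter, which is a union of `n + 1` families each of which is `D`-discrete. -/
def AsdimLE (X : Type*) [MetricSpace X] (n : ℕ) : Prop :=
  ∀ D : ℝ, 0 ≤ D → ∃ 𝓤 : Fin (n + 1) → Set (Set X),
    (∀ x : X, ∃ i, ∃ U ∈ 𝓤 i, x ∈ U) ∧
    (∃ R : ℝ, ∀ i, ∀ U ∈ 𝓤 i, ∀ x ∈ U, ∀ y ∈ U, dist x y ≤ R) ∧
    ∀ i, IsDiscreteFamily D (𝓤 i)

/-- The asymptotic dimension: the least `n` with `asdim X ≤ n`, and `∞` if there is none. -/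
noncomputable def asdim (X : Type*) [MetricSpace X] : ℕ∞ :=
  ⨅ (n : ℕ) (_ : AsdimLE X n), (n : ℕ∞)

/-- A group is finite-by-abelian if it has a finite normal subgroup with abelian quotient. -/
def IsFiniteByAbelian (G : Type*) [Group G] : Prop :=
  ∃ (N : Subgroup G) (_ : N.Normal), Finite N ∧ ∀ a b : G ⧸ N, a * b = b * a

/-- A group is locally finite-by-abelian if each finitely generated subgroup is
finite-by-abelian. -/
def IsLocallyFiniteByAbelian (G : Type*) [Group G] : Prop :=
  ∀ K : Subgroup G, K.FG → IsFiniteByAbelian K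

/-! A countable group with a proper left-invariant metric is discrete with finite balls, so only
finite sets of differences `x⁻¹ * y` matter. Finite generation and asymptotic dimension are coarse
invariants, which gives one direction.

For the converse, torsion elements are closed under products and contain the commutator subgroup,
and each finitely generated subgroup has only finitely many of them. The map of `G` to the
rationalization of its abelianization therefore has locally finite kernel. Choosing a basis among
the images of group elements gives `RatCoords`, indexed by `Fin n` or by `ℕ`. The finite subsets of
`G` are then the sets of bounded coordinates inside finitely generated subgroups
(`RatCoords.finite_bounded`). The asymptotic dimension equals the rank: a brick cover bounds it
above, and a discrete Poincaré–Miranda theorem, proved with mod 2 cubical cochains, bounds it below.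
It remains to show that groups of equal rank, both or neither finitely generated, are coarsely
equivalent.

In infinite rank, `G` is exhausted by finitely generated subgroups `K i` of rank `i`. The cosets of
`K i` in `K (i + 1)` are enumerated by `ℤ` nearly linearly in the new coordinate, and assembling the
enumerations compares `G` with a direct sum of copies of `ℤ`.

In finite rank, exhaust both groups by finitely generated subgroups of full rank. Successive indices
are finite, and coordinates can be adjusted freely inside the smallest subgroup, so a map respecting
the two towers of cosets suffices. If the groups are finitely generated, constant towers do.
Otherwise indices can be made arbitrarily large, and one builds maps alternating between the two
towers whose fibres have controlled size (`exists_fibre_ranges`, `exists_interleavedUpTo`). These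
reach any finite level, and an ultrafilter limit gives a map respecting all levels. -/

/-! ### From proper metrics to finite sets of differences -/

theorem finite_closedBall_of_countable {G : Type*} [Group G] [Countable G] [MetricSpace G]
    [ProperSpace G] [IsIsometricSMul G G] (x : G) (r : ℝ) : (Metric.closedBall x r).Finite := by
  -- Baire: a countable union of singletons fills the complete space `G`, so some point is open, and
  -- by translation every point is.
  obtain ⟨g, hg⟩ := nonempty_interior_of_iUnion_of_closed (f := fun g : G => ({g} : Set G))
    (fun _ => isClosed_singleton) (by ext; simp)
  have hopen : IsOpen ({g} : Set G) := by
    have h : interior ({g} : Set G) = {g} :=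
      (interior_subset).antisymm (by
        obtain ⟨y, hy⟩ := hg
        have := interior_subset hy
        simp only [Set.mem_singleton_iff] at this
        subst this
        simpa using hy)
    rw [← h]; exact isOpen_interior
  have hall : ∀ a : G, IsOpen ({a} : Set G) := by
    intro a
    have h := hopen.preimage ((isometry_smul G (g * a⁻¹)).continuous)
    convert h using 1
    ext b
    simp only [Set.mem_singleton_iff, Set.mem_preimage, smul_eq_mul]
    constructor
    · rintro rfl; simp
    · intro h
      have : g * a⁻¹ * b = g * a⁻¹ * a := by rw [h]; simp
      exact mul_left_cancel this
  have : DiscreteTopology G := discreteTopology_iff_isOpen_singleton.2 hall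
  exact (isCompact_closedBall x r).finite_of_discrete

theorem dist_eq_dist_one_inv_mul {G : Type*} [Group G] [MetricSpace G] [IsIsometricSMul G G]
    (x y : G) : dist x y = dist 1 (x⁻¹ * y) := by
  have := dist_smul (x⁻¹) x y
  simpa using this.symm

/-- A map of groups that is bornologous for the coarse structures given by finite sets. -/
def FinitelyControlled {G H : Type*} [Group G] [Group H] (f : G → H) : Prop :=
  ∀ F : Set G, F.Finite → ∃ F' : Set H, F'.Finite ∧ ∀ x y, x⁻¹ * y ∈ F → (f x)⁻¹ * f y ∈ F'

/-- The converse control: close images come from close points. -/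
def FinitelyProper {G H : Type*} [Group G] [Group H] (f : G → H) : Prop :=
  ∀ F : Set H, F.Finite → ∃ F' : Set G, F'.Finite ∧ ∀ x y, (f x)⁻¹ * f y ∈ F → x⁻¹ * y ∈ F'

theorem exists_forall_dist_le_of_finite {G : Type*} [Group G] [MetricSpace G] [IsIsometricSMul G G]
    {F : Set G} (hF : F.Finite) :
    ∃ C : ℝ, ∀ x y : G, x⁻¹ * y ∈ F → dist x y ≤ C := by
  obtain ⟨C, hC⟩ := (hF.image (fun g : G => dist 1 g)).bddAbove
  refine ⟨C, fun x y h => ?_⟩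
  rw [dist_eq_dist_one_inv_mul]
  exact hC ⟨_, h, rfl⟩

theorem inv_mul_mem_closedBall {G : Type*} [Group G] [MetricSpace G]
    [IsIsometricSMul G G] {x y : G} {C : ℝ} (h : dist x y ≤ C) :
    x⁻¹ * y ∈ Metric.closedBall (1 : G) C := by
  rw [Metric.mem_closedBall, dist_comm, ← dist_eq_dist_one_inv_mul]; exact h

section
variable {G H : Type*}
    [Group G] [Countable G] [MetricSpace G] [ProperSpace G] [IsIsometricSMul G G]
    [Group H] [Countable H] [MetricSpace H] [ProperSpace H] [IsIsometricSMul H H]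

/-- Balls are finite and finite sets lie in balls, so both control conditions translate into metric
bounds. A choice of approximate preimages is the coarse inverse, bornologous because `f` is proper
in this sense. -/
theorem coarselyEquivalent_of_finitely {f : G → H} (h1 : FinitelyControlled f)
    (h2 : FinitelyProper f) {F : Set H} (hF : F.Finite) (h3 : ∀ y, ∃ x, (f x)⁻¹ * y ∈ F) :
    CoarselyEquivalent G H := by
  choose g hg using h3
  have hborn : ∀ C : ℝ, ∃ C' : ℝ, ∀ x x', dist (f x) (f x') ≤ C → dist x x' ≤ C' := by
    intro C
    obtain ⟨F', hF', h⟩ := h2 _ (finite_closedBall_of_countable (1 : H) C)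
    obtain ⟨C', hC'⟩ := exists_forall_dist_le_of_finite hF'
    exact ⟨C', fun x x' hx => hC' _ _ (h _ _ (inv_mul_mem_closedBall hx))⟩
  obtain ⟨K, hK⟩ := exists_forall_dist_le_of_finite hF
  have hfg : ∀ y, dist (f (g y)) y ≤ K := fun y => hK _ _ (hg y)
  obtain ⟨K', hK'⟩ := hborn K
  refine ⟨f, g, max K K', ?_, ?_, ?_, fun y => (hfg y).trans (le_max_left _ _)⟩
  · intro δ
    obtain ⟨F', hF', h⟩ := h1 _ (finite_closedBall_of_countable (1 : G) δ)
    obtain ⟨C', hC'⟩ := exists_forall_dist_le_of_finite hF'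
    exact ⟨C', fun x x' hx => hC' _ _ (h _ _ (inv_mul_mem_closedBall hx))⟩
  · intro δ
    obtain ⟨C, hC⟩ := hborn (K + δ + K)
    refine ⟨C, fun y y' h => hC _ _ ?_⟩
    have h4 := dist_triangle4 (f (g y)) y y' (f (g y'))
    have h5 := hfg y
    have h6 := hfg y'
    rw [dist_comm] at h6
    linarith
  · intro x
    exact (hK' _ _ (hfg (f x))).trans (le_max_right _ _)

end

/-! ### Coarse invariance of finite generation and of asymptotic dimension -/

theorem CoarselyEquivalent.fg {G H : Type*} [Group G] [MetricSpace G] [IsIsometricSMul G G]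
    [Group H] [Countable H] [MetricSpace H] [ProperSpace H] [IsIsometricSMul H H]
    (h : CoarselyEquivalent G H) (hG : Group.FG G) : Group.FG H := by
  obtain ⟨f, g, K, hf, -, -, hK⟩ := h
  obtain ⟨S, hS⟩ := Group.fg_iff.1 hG
  obtain ⟨hS, hSf⟩ := hS
  obtain ⟨r, hr⟩ := (hSf.image (fun g : G => dist 1 g)).bddAbove
  obtain ⟨C, hC⟩ := hf r
  -- Radius `C` captures the image of one generator step in `G`; radius `K` captures the error
  -- between `f (g y)` and `y`.
  set L : Subgroup H := Subgroup.closure (Metric.closedBall (1 : H) (max C K)) with hL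
  have hmem : ∀ y y' : H, dist y y' ≤ max C K → y⁻¹ * y' ∈ L := fun y y' h =>
    Subgroup.subset_closure (inv_mul_mem_closedBall h)
  have hstep : ∀ x : G, ∀ s ∈ S, (f x)⁻¹ * f (x * s) ∈ L := by
    intro x s hs
    refine hmem _ _ ((hC _ _ ?_).trans (le_max_left _ _))
    rw [dist_eq_dist_one_inv_mul]
    simpa using hr ⟨s, hs, rfl⟩
  have hconst : ∀ x : G, (f 1)⁻¹ * f x ∈ L := by
    intro x
    have hx : x ∈ Subgroup.closure S := by rw [hS]; trivial
    induction hx using Subgroup.closure_induction_right with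
    | one => simp
    | mul_right x hx y hy ih =>
      have := L.mul_mem ih (hstep x y hy)
      simpa [mul_assoc] using this
    | mul_inv_cancel x hx y hy ih =>
      have h := hstep (x * y⁻¹) y hy
      have := L.mul_mem ih (L.inv_mem h)
      simpa [mul_assoc] using this
  have hall : ∀ y : H, (f 1)⁻¹ * y ∈ L := by
    intro y
    have := L.mul_mem (hconst (g y)) (hmem _ _ ((hK y).trans (le_max_right _ _)))
    simpa [mul_assoc] using this
  refine Group.fg_iff.2 ⟨_, ?_, finite_closedBall_of_countable (1 : H) (max C K)⟩
  rw [← hL, eq_top_iff]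
  intro y _
  have := L.mul_mem (L.inv_mem (hall 1)) (hall y)
  simpa [mul_assoc] using this

theorem CoarselyEquivalent.symm {X Y : Type*} [MetricSpace X] [MetricSpace Y]
    (h : CoarselyEquivalent X Y) : CoarselyEquivalent Y X := by
  obtain ⟨f, g, K, hf, hg, h1, h2⟩ := h
  exact ⟨g, f, K, hg, hf, h2, h1⟩

theorem CoarselyEquivalent.asdimLE {X Y : Type*} [MetricSpace X] [MetricSpace Y] {n : ℕ}
    (h : CoarselyEquivalent X Y) (hX : AsdimLE X n) : AsdimLE Y n := by
  obtain ⟨f, g, K, hf, hg, h1, h2⟩ := h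
  intro D hD
  obtain ⟨C, hC⟩ := hg D
  -- The cover of `Y` is the preimage under `g` of one of `X`. Points at distance below `D` map to
  -- points at most `C` apart, so discreteness strictly above `C` is needed.
  obtain ⟨𝓤, hcov, ⟨R, hR⟩, hdisc⟩ := hX (max C 0 + 1) (by positivity)
  obtain ⟨R', hR'⟩ := hf R
  refine ⟨fun i => (fun U => g ⁻¹' U) '' 𝓤 i, ?_, ⟨K + R' + K, ?_⟩, ?_⟩
  · intro y
    obtain ⟨i, U, hU, hy⟩ := hcov (g y)
    exact ⟨i, _, ⟨U, hU, rfl⟩, hy⟩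
  · rintro i _ ⟨U, hU, rfl⟩ x hx y hy
    have h3 := hR' _ _ (hR i U hU _ hx _ hy)
    have h4 := dist_triangle4 x (f (g x)) (f (g y)) y
    have h5 := h2 x
    have h6 := h2 y
    rw [dist_comm] at h5
    linarith
  · rintro i _ ⟨U, hU, rfl⟩ _ ⟨V, hV, rfl⟩ hne u hu v hv
    have hUV : U ≠ V := fun h => hne (by rw [h])
    have h3 := hdisc i U hU V hV hUV _ hu _ hv
    by_contra! h4
    have h5 := hC _ _ h4.le
    have := le_max_left C 0
    linarith

theorem CoarselyEquivalent.asdim_eq {X Y : Type*} [MetricSpace X] [MetricSpace Y]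
    (h : CoarselyEquivalent X Y) : asdim X = asdim Y := by
  have : ∀ n, AsdimLE X n ↔ AsdimLE Y n := fun n => ⟨h.asdimLE, h.symm.asdimLE⟩
  simp only [asdim, this]

theorem asdim_eq_coe {X : Type*} [MetricSpace X] {n : ℕ} (h : AsdimLE X n)
    (h' : ∀ k, AsdimLE X k → n ≤ k) : asdim X = n :=
  le_antisymm (iInf₂_le n h) (le_iInf₂ fun k hk => by exact_mod_cast h' k hk)

theorem asdim_eq_top {X : Type*} [MetricSpace X] (h : ∀ k, ¬ AsdimLE X k) : asdim X = ⊤ := by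
  simp [asdim, h]

/-! ### Mod 2 cubical cochains and a discrete Poincaré–Miranda theorem -/

section CubicalForms
variable {ι : Type*} [DecidableEq ι]

/-- The cup product of `dh` with a cubical cochain mod 2. -/
def cupDiff (h : (ι → ℕ) → ZMod 2) (ω : Finset ι → (ι → ℕ) → ZMod 2) :
    Finset ι → (ι → ℕ) → ZMod 2 :=
  fun S x => ∑ k ∈ S, (h (x + Pi.single k 1) + h x) * ω (S.erase k) (x + Pi.single k 1)

/-- The coboundary of a cubical cochain mod 2. -/
def coboundary (ω : Finset ι → (ι → ℕ) → ZMod 2) : Finset ι → (ι → ℕ) → ZMod 2 :=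
  fun S x => ∑ k ∈ S, (ω (S.erase k) (x + Pi.single k 1) + ω (S.erase k) x)

/-- The Leibniz rule for a function times a closed cochain. A cochain takes as arguments the set `S`
of directions of a cube and its lowest corner `x`; working mod 2 removes all signs. -/
theorem coboundary_mul (h : (ι → ℕ) → ZMod 2) {ω : Finset ι → (ι → ℕ) → ZMod 2}
    (hω : coboundary ω = 0) : coboundary (fun S x => h x * ω S x) = cupDiff h ω := by
  funext S x
  have h0 : coboundary ω S x = 0 := by rw [hω]; rfl
  have h2 : cupDiff h ω S x = cupDiff h ω S x + h x * coboundary ω S x := by rw [h0]; ring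
  rw [h2]
  simp only [coboundary, cupDiff, Finset.mul_sum, ← Finset.sum_add_distrib]
  refine Finset.sum_congr rfl fun k _ => ?_
  have : h x * ω (S.erase k) (x + Pi.single k 1) + h x * ω (S.erase k) (x + Pi.single k 1) = 0 :=
    CharTwo.add_self_eq_zero _
  linear_combination -this

theorem coboundary_coboundary (ω : Finset ι → (ι → ℕ) → ZMod 2) :
    coboundary (coboundary ω) = 0 := by
  funext S x
  simp only [coboundary, ← Finset.sum_add_distrib, Pi.zero_apply]
  rw [Finset.sum_sigma']
  -- The terms for removing `k` then `l` and `l` then `k` agree, so they cancel mod 2.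
  refine Finset.sum_involution (fun p _ => ⟨p.2, p.1⟩) ?_ ?_ ?_ ?_
  · rintro ⟨k, l⟩ h
    simp only
    rw [Finset.erase_right_comm (a := l), add_right_comm x (Pi.single l 1)]
    generalize ω ((S.erase k).erase l) = η
    have e : ∀ a : ZMod 2, a + a = 0 := CharTwo.add_self_eq_zero
    linear_combination e (η (x + Pi.single k 1 + Pi.single l 1)) + e (η (x + Pi.single k 1))
      + e (η (x + Pi.single l 1)) + e (η x)
  · rintro ⟨k, l⟩ h _ heq
    simp only [Finset.mem_sigma, Finset.mem_erase] at h
    simp only [Sigma.mk.injEq] at heq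
    exact h.2.1 heq.1
  · rintro ⟨k, l⟩ h
    simp only [Finset.mem_sigma, Finset.mem_erase] at h ⊢
    exact ⟨h.2.2, fun h' => h.2.1 h'.symm, h.1⟩
  · rintro ⟨k, l⟩ h
    rfl

/-- The product `dh₁ ∪ ⋯ ∪ dhₘ` of the functions indexed by a list. -/
def cupList (h : ι → (ι → ℕ) → ZMod 2) : List ι → Finset ι → (ι → ℕ) → ZMod 2
  | [] => fun S _ => if S = ∅ then 1 else 0
  | i :: L => cupDiff (h i) (cupList h L)

theorem coboundary_cupList (h : ι → (ι → ℕ) → ZMod 2) (L : List ι) :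
    coboundary (cupList h L) = 0 := by
  cases L with
  | nil =>
    funext S x
    exact Finset.sum_eq_zero fun k _ => CharTwo.add_self_eq_zero _
  | cons i L =>
    show coboundary (cupDiff (h i) (cupList h L)) = 0
    rw [← coboundary_mul (h i) (coboundary_cupList h L), coboundary_coboundary]

/-- The differential of `h k` vanishes along a hyperplane on which `h k` is constant, and with it
every product containing that factor. -/
theorem cupList_eq_zero_of_face {h : ι → (ι → ℕ) → ZMod 2} {k : ι} {c : ℕ}
    (hk : ∀ x y, x k = c → y k = c → h k x = h k y) {L : List ι} (hL : k ∈ L) :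
    ∀ {S : Finset ι} {x : ι → ℕ}, k ∉ S → x k = c → cupList h L S x = 0 := by
  induction L with
  | nil => simp at hL
  | cons j L ih =>
    intro S x hS hx
    refine Finset.sum_eq_zero fun l hl => ?_
    have hlk : k ≠ l := fun e => hS (e ▸ hl)
    have hx' : (x + Pi.single l 1 : ι → ℕ) k = c := by simp [hx, Pi.single_eq_of_ne hlk]
    by_cases hj : j = k
    · subst hj
      rw [hk _ x hx' hx, CharTwo.add_self_eq_zero, zero_mul]
    · have hkL : k ∈ L := by
        rcases List.mem_cons.1 hL with h | h
        · exact absurd h.symm hj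
        · exact h
      rw [ih hkL (fun hm => hS (Finset.mem_of_mem_erase hm)) hx', mul_zero]

theorem exists_ne_of_cupList_ne_zero {h : ι → (ι → ℕ) → ZMod 2} {L : List ι} :
    ∀ {S : Finset ι} {x : ι → ℕ}, cupList h L S x ≠ 0 → ∀ i ∈ L, ∃ y y' : ι → ℕ,
      (∀ j, x j ≤ y j ∧ y j ≤ x j + if j ∈ S then 1 else 0) ∧
      (∀ j, x j ≤ y' j ∧ y' j ≤ x j + if j ∈ S then 1 else 0) ∧ h i y ≠ h i y' := by
  induction L with
  | nil => simp
  | cons a L ih =>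
    intro S x hne i hi
    obtain ⟨k, hk, hk'⟩ := Finset.exists_ne_zero_of_sum_ne_zero hne
    have hsing : ∀ j, (Pi.single k 1 : ι → ℕ) j = if j = k then 1 else 0 := fun j => by
      rw [Pi.single_apply]
    rcases List.mem_cons.1 hi with rfl | hiL
    · refine ⟨x + Pi.single k 1, x, fun j => ?_, fun j => by simp, fun he => ?_⟩
      · rw [Pi.add_apply, hsing]
        by_cases hj : j = k
        · subst hj; simp [hk]
        · simp [hj]
      · apply left_ne_zero_of_mul hk'
        rw [he]; exact CharTwo.add_self_eq_zero _
    · obtain ⟨y, y', h1, h2, h3⟩ := ih (right_ne_zero_of_mul hk') i hiL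
      have key : ∀ z : ι → ℕ, (∀ j, (x + Pi.single k 1 : ι → ℕ) j ≤ z j ∧
          z j ≤ (x + Pi.single k 1 : ι → ℕ) j + if j ∈ S.erase k then 1 else 0) →
          ∀ j, x j ≤ z j ∧ z j ≤ x j + if j ∈ S then 1 else 0 := by
        intro z hz j
        have := hz j
        rw [Pi.add_apply, hsing] at this
        by_cases hj : j = k
        · subst hj; simp [hk] at this ⊢; omega
        · simp [hj] at this ⊢; omega
      exact ⟨y, y', key y h1, key y' h2, h3⟩

variable [Fintype ι]

/-- The face of the cube `[0, N]` spanned by the directions in `S`, where the other coordinates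
are equal to `N`. -/
def gridBox (N : ℕ) (S : Finset ι) : Finset (ι → ℕ) :=
  Fintype.piFinset fun k => if k ∈ S then Finset.range N else {N}

theorem mem_gridBox {N : ℕ} {S : Finset ι} {x : ι → ℕ} :
    x ∈ gridBox N S ↔ ∀ k, if k ∈ S then x k < N else x k = N := by
  simp only [gridBox, Fintype.mem_piFinset]
  refine forall_congr' fun k => ?_
  split_ifs <;> simp

/-- Stokes in one direction: the differences telescope along lines parallel to the `k`-axis, leaving
the two opposite faces. -/
theorem sum_gridBox_telescope (N : ℕ) {S : Finset ι} {k : ι} (hk : k ∈ S)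
    (F : (ι → ℕ) → ZMod 2) :
    ∑ x ∈ gridBox N S, (F (x + Pi.single k 1) + F x) =
      ∑ x ∈ gridBox N (S.erase k), (F x + F (Function.update x k 0)) := by
  have h1 : ∑ x ∈ gridBox N S, (F (x + Pi.single k 1) + F x) =
      ∑ p ∈ gridBox N (S.erase k) ×ˢ Finset.range N,
        (F (Function.update p.1 k (p.2 + 1)) + F (Function.update p.1 k p.2)) := by
    refine Finset.sum_bij' (fun x _ => (Function.update x k N, x k))
      (fun p _ => Function.update p.1 k p.2) ?_ ?_ ?_ ?_ ?_
    · intro x hx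
      rw [mem_gridBox] at hx
      rw [Finset.mem_product, mem_gridBox, Finset.mem_range]
      refine ⟨fun j => ?_, by simpa [hk] using hx k⟩
      by_cases hj : j = k
      · subst hj; simp
      · simpa [hj] using hx j
    · rintro ⟨x, t⟩ hp
      rw [Finset.mem_product, mem_gridBox, Finset.mem_range] at hp
      rw [mem_gridBox]
      intro j
      by_cases hj : j = k
      · subst hj; simpa [hk] using hp.2
      · simpa [hj] using hp.1 j
    · intro x _; simp
    · rintro ⟨x, t⟩ hp
      rw [Finset.mem_product, mem_gridBox] at hp
      have : x k = N := by simpa using hp.1 k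
      simp [← this]
    · intro x _
      simp only [Function.update_idem, Function.update_eq_self]
      congr 2
      funext j
      by_cases hj : j = k
      · subst hj; simp
      · simp [hj]
  rw [h1, Finset.sum_product]
  refine Finset.sum_congr rfl fun x hx => ?_
  have hxk : x k = N := by simpa using mem_gridBox.1 hx k
  have h2 : ∀ M : ℕ, ∑ t ∈ Finset.range M,
      (F (Function.update x k (t + 1)) + F (Function.update x k t)) =
      F (Function.update x k M) + F (Function.update x k 0) := by
    intro M
    induction M with
    | zero => simp [CharTwo.add_self_eq_zero]
    | succ M ih =>
      rw [Finset.sum_range_succ, ih]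
      linear_combination CharTwo.add_self_eq_zero (F (Function.update x k M))
  rw [h2, ← hxk, Function.update_eq_self]

/-- The product is the coboundary of `h i` times the remaining product, so Stokes turns the sum into
one over faces. Faces transverse to `k ≠ i` contribute nothing because the differential of `h k`
vanishes there. On the faces transverse to `i`, `h i` is `0` and `1`, which leaves the same sum in
one dimension less. -/
theorem sum_gridBox_cupList {N : ℕ} {h : ι → (ι → ℕ) → ZMod 2}
    (h0 : ∀ i x, x i = 0 → h i x = 0) (h1 : ∀ i x, x i = N → h i x = 1) {L : List ι}
    (hL : L.Nodup) : ∑ x ∈ gridBox N L.toFinset, cupList h L L.toFinset x = 1 := by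
  induction L with
  | nil =>
    have : gridBox N (∅ : Finset ι) = {fun _ => N} := by
      ext x; rw [mem_gridBox]; simp [funext_iff]
    simp [cupList, this]
  | cons i L ih =>
    rw [List.nodup_cons] at hL
    have hiL : i ∉ L.toFinset := by simpa using hL.1
    have herase : (insert i L.toFinset).erase i = L.toFinset := Finset.erase_insert hiL
    rw [List.toFinset_cons]
    simp only [cupList]
    rw [← coboundary_mul (h i) (coboundary_cupList h L)]
    simp only [coboundary]
    rw [Finset.sum_comm]
    rw [Finset.sum_congr rfl fun k hk => sum_gridBox_telescope N hk
      (fun x => h i x * cupList h L ((insert i L.toFinset).erase k) x)]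
    rw [Finset.sum_insert hiL, herase, Finset.sum_eq_zero (s := L.toFinset), add_zero]
    · rw [← ih hL.2]
      refine Finset.sum_congr rfl fun x hx => ?_
      have hxi : x i = N := by simpa [hL.1] using mem_gridBox.1 hx i
      rw [h1 i x hxi, h0 i _ (Function.update_self ..)]
      ring
    · intro k hk
      refine Finset.sum_eq_zero fun x hx => ?_
      have hxk : x k = N := by simpa using mem_gridBox.1 hx k
      have hkL : k ∈ L := by simpa using hk
      have z1 : cupList h L ((insert i L.toFinset).erase k) x = 0 :=
        cupList_eq_zero_of_face (c := N) (fun x y hx hy => by rw [h1 k x hx, h1 k y hy]) hkL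
          (Finset.notMem_erase _ _) hxk
      have z2 : cupList h L ((insert i L.toFinset).erase k) (Function.update x k 0) = 0 :=
        cupList_eq_zero_of_face (c := 0) (fun x y hx hy => by rw [h0 k x hx, h0 k y hy]) hkL
          (Finset.notMem_erase _ _) (by simp)
      rw [z1, z2]; ring

/-- A discrete form of the Poincaré–Miranda theorem: if `h i` separates the faces `x i = 0` and
`x i = N` for each `i`, then some unit cube has no `h i` constant on it. -/
theorem exists_cube_forall_not_constant {N : ℕ} {h : ι → (ι → ℕ) → ZMod 2}
    (h0 : ∀ i x, x i = 0 → h i x = 0) (h1 : ∀ i x, x i = N → h i x = 1) :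
    ∃ x : ι → ℕ, ∀ i, ∃ y y' : ι → ℕ, (∀ j, x j ≤ y j ∧ y j ≤ x j + 1) ∧
      (∀ j, x j ≤ y' j ∧ y' j ≤ x j + 1) ∧ h i y ≠ h i y' := by
  have hs := sum_gridBox_cupList h0 h1 (Finset.nodup_toList (Finset.univ : Finset ι))
  rw [Finset.toList_toFinset] at hs
  obtain ⟨x, -, hx⟩ := Finset.exists_ne_zero_of_sum_ne_zero (hs.trans_ne one_ne_zero)
  refine ⟨x, fun i => ?_⟩
  obtain ⟨y, y', h1, h2, h3⟩ := exists_ne_of_cupList_ne_zero hx i (by simp)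
  exact ⟨y, y', by simpa using h1, by simpa using h2, h3⟩
end CubicalForms

/-- A homomorphism from `G` to a rational vector space with coordinates indexed by `ι`, having
the unit vectors in its image and a locally finite kernel. -/
structure RatCoords (G : Type*) [Group G] (ι : Type*) where
  φ : G → ι → ℚ
  map_mul : ∀ x y, φ (x * y) = φ x + φ y
  finite_support : ∀ x, {i | φ x i ≠ 0}.Finite
  z : ι → G
  φ_z_self : ∀ i, φ (z i) i = 1
  φ_z_ne : ∀ i j, j ≠ i → φ (z i) j = 0
  finite_ker : ∀ K : Subgroup G, K.FG → {k | k ∈ K ∧ φ k = 0}.Finite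

/-! ### Torsion elements and the construction of rational coordinates -/

theorem CommGroup.finite_setOf_isOfFinOrder {Q : Type*} [CommGroup Q] [Group.FG Q] :
    {q : Q | IsOfFinOrder q}.Finite := by
  have : Group.FG (CommGroup.torsion Q) := by
    have hn : IsNoetherian ℤ (Additive Q) := by
      have : Module.Finite ℤ (Additive Q) :=
        Module.Finite.iff_addGroup_fg.2 (GroupFG.iff_add_fg.1 inferInstance)
      infer_instance
    have h := hn.noetherian (AddSubgroup.toIntSubmodule (Subgroup.toAddSubgroup (CommGroup.torsion Q)))
    rw [Submodule.fg_iff_addSubgroup_fg] at h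
    rw [Group.fg_iff_subgroup_fg, Subgroup.fg_iff_add_fg]
    exact h
  have hfin : Finite (CommGroup.torsion Q) :=
    CommGroup.finite_of_fg_isMulTorsion _ fun q =>
      (Submonoid.isOfFinOrder_coe (H := (CommGroup.torsion Q).toSubmonoid)).1 q.2
  exact hfin

section
variable {G : Type*} [Group G]

open scoped commutatorElement

theorem IsLocallyFiniteByAbelian.isOfFinOrder_mul (hG : IsLocallyFiniteByAbelian G) {x y : G}
    (hx : IsOfFinOrder x) (hy : IsOfFinOrder y) : IsOfFinOrder (x * y) := by
  set K : Subgroup G := Subgroup.closure {x, y}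
  obtain ⟨N, hN, hfin, hcomm⟩ := hG K ((Subgroup.fg_iff _).2 ⟨{x, y}, rfl, Set.toFinite _⟩)
  let x' : K := ⟨x, Subgroup.subset_closure (by simp)⟩
  let y' : K := ⟨y, Subgroup.subset_closure (by simp)⟩
  obtain ⟨m, hm, hxm⟩ := isOfFinOrder_iff_pow_eq_one.1 hx
  obtain ⟨n, hn, hyn⟩ := isOfFinOrder_iff_pow_eq_one.1 hy
  have hxm' : x' ^ m = 1 := Subtype.ext hxm
  have hyn' : y' ^ n = 1 := Subtype.ext hyn
  have h1 : (x' * y') ^ (m * n) ∈ N := by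
    rw [← QuotientGroup.eq_one_iff, QuotientGroup.mk_pow, QuotientGroup.mk_mul,
      (show Commute (x' : K ⧸ N) (y' : K ⧸ N) from hcomm _ _).mul_pow, ← QuotientGroup.mk_pow,
      ← QuotientGroup.mk_pow, pow_mul, hxm', mul_comm m n, pow_mul, hyn']
    simp
  obtain ⟨k, hk, hk'⟩ := isOfFinOrder_iff_pow_eq_one.1 (isOfFinOrder_of_finite
    (⟨(x' * y') ^ (m * n), h1⟩ : N))
  refine isOfFinOrder_iff_pow_eq_one.2 ⟨m * n * k, by positivity, ?_⟩
  rw [pow_mul]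
  have := congrArg (fun t : N => ((t : K) : G)) hk'
  simpa using this

theorem IsLocallyFiniteByAbelian.isOfFinOrder_commutator (hG : IsLocallyFiniteByAbelian G)
    (x y : G) : IsOfFinOrder ⁅x, y⁆ := by
  set K : Subgroup G := Subgroup.closure {x, y}
  obtain ⟨N, hN, hfin, hcomm⟩ := hG K ((Subgroup.fg_iff _).2 ⟨{x, y}, rfl, Set.toFinite _⟩)
  let x' : K := ⟨x, Subgroup.subset_closure (by simp)⟩
  let y' : K := ⟨y, Subgroup.subset_closure (by simp)⟩
  have h1 : ⁅x', y'⁆ ∈ N := by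
    rw [← QuotientGroup.eq_one_iff, commutatorElement_def]
    simp only [QuotientGroup.mk_mul, QuotientGroup.mk_inv]
    rw [hcomm (x' : K ⧸ N) (y' : K ⧸ N)]
    simp
  have h2 := isOfFinOrder_of_finite (⟨⁅x', y'⁆, h1⟩ : N)
  have h3 := (K.subtype.comp N.subtype).isOfFinOrder h2
  exact h3

theorem IsLocallyFiniteByAbelian.isOfFinOrder_of_mem_commutator
    (hG : IsLocallyFiniteByAbelian G) {x : G} (hx : x ∈ commutator G) : IsOfFinOrder x := by
  rw [commutator_eq_closure] at hx
  induction hx using Subgroup.closure_induction with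
  | mem x hx => obtain ⟨a, b, rfl⟩ := hx; exact hG.isOfFinOrder_commutator a b
  | one => exact IsOfFinOrder.one
  | mul x y _ _ hx hy => exact hG.isOfFinOrder_mul hx hy
  | inv x _ hx => exact hx.inv

/-- A torsion element maps to torsion in a finitely generated abelian quotient with finite kernel:
there are finitely many images, each with finite fibre. -/
theorem IsLocallyFiniteByAbelian.finite_isOfFinOrder (hG : IsLocallyFiniteByAbelian G)
    {K : Subgroup G} (hK : K.FG) : {k | k ∈ K ∧ IsOfFinOrder k}.Finite := by
  obtain ⟨N, hN, hfin, hcomm⟩ := hG K hK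
  let _ : CommGroup (K ⧸ N) := { QuotientGroup.Quotient.group N with mul_comm := hcomm }
  have : Group.FG K := (Group.fg_iff_subgroup_fg K).2 hK
  have h1 : {q : K ⧸ N | IsOfFinOrder q}.Finite := CommGroup.finite_setOf_isOfFinOrder
  have h2 : ((QuotientGroup.mk' N) ⁻¹' {q : K ⧸ N | IsOfFinOrder q}).Finite := by
    refine h1.preimage' fun q _ => ?_
    obtain ⟨k, rfl⟩ := QuotientGroup.mk'_surjective N q
    have h3 : (Set.range fun n : N => k * (n : K)).Finite := Set.finite_range _
    refine h3.subset fun k' hk' => ?_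
    have : k⁻¹ * k' ∈ N := by
      rw [← QuotientGroup.eq]; exact (Set.mem_singleton_iff.1 hk').symm
    exact ⟨⟨_, this⟩, by simp⟩
  refine (h2.image (Subtype.val : K → G)).subset ?_
  rintro k ⟨hk, hk'⟩
  refine ⟨⟨k, hk⟩, ?_, rfl⟩
  refine (QuotientGroup.mk' N).isOfFinOrder ?_
  exact (Submonoid.isOfFinOrder_coe (H := K.toSubmonoid) (x := ⟨k, hk⟩)).1 hk'

open TensorProduct in
/-- The canonical map of a group to the rationalization of its abelianization. -/
noncomputable def rationalization (G : Type*) [Group G] (g : G) :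
    ℚ ⊗[ℤ] Additive (Abelianization G) :=
  (1 : ℚ) ⊗ₜ[ℤ] Additive.ofMul (Abelianization.of g)

theorem rationalization_mul (x y : G) :
    rationalization G (x * y) = rationalization G x + rationalization G y := by
  simp [rationalization, TensorProduct.tmul_add]

theorem span_range_rationalization :
    (⊤ : Submodule ℚ (TensorProduct ℤ ℚ (Additive (Abelianization G)))) ≤
      Submodule.span ℚ (Set.range (rationalization G)) := by
  rintro v -
  induction v using TensorProduct.induction_on with
  | zero => exact Submodule.zero_mem _
  | add x y hx hy => exact Submodule.add_mem _ hx hy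
  | tmul q a =>
    obtain ⟨g, hg⟩ := QuotientGroup.mk_surjective a.toMul
    have : q ⊗ₜ[ℤ] a = q • rationalization G g := by
      rw [rationalization, TensorProduct.smul_tmul', smul_eq_mul, mul_one]
      congr 1
      exact (congrArg Additive.ofMul hg).symm
    rw [this]
    exact Submodule.smul_mem _ _ (Submodule.subset_span ⟨g, rfl⟩)

/-- Rationalization is localization at the nonzero integers, so it kills only torsion: a power of
`g` lies in the commutator subgroup, all of whose elements have finite order. -/
theorem IsLocallyFiniteByAbelian.isOfFinOrder_of_rationalization_eq_zero
    (hG : IsLocallyFiniteByAbelian G) {g : G} (hg : rationalization G g = 0) :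
    IsOfFinOrder g := by
  have h := (IsLocalizedModule.eq_zero_iff (nonZeroDivisors ℤ)
    (TensorProduct.mk ℤ ℚ (Additive (Abelianization G)) 1)).1 hg
  obtain ⟨⟨n, hn⟩, h⟩ := h
  have hn0 : n ≠ 0 := nonZeroDivisors.ne_zero hn
  have h1 : Abelianization.of (g ^ n) = 1 := by
    rw [map_zpow]
    exact congrArg Additive.toMul h
  have h2 : g ^ n ∈ commutator G := by
    rw [← Abelianization.ker_of]; exact h1
  obtain ⟨m, hm, h3⟩ := (isOfFinOrder_iff_zpow_eq_one).1 (hG.isOfFinOrder_of_mem_commutator h2)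
  exact isOfFinOrder_iff_zpow_eq_one.2 ⟨n * m, mul_ne_zero hn0 hm, by rw [zpow_mul, h3]⟩

/-- The images of group elements span, so a basis can be extracted from them; this is why the unit
vectors are attained. The basis is countable because `G` is. -/
theorem IsLocallyFiniteByAbelian.exists_ratCoords [Countable G]
    (hG : IsLocallyFiniteByAbelian G) :
    (∃ n : ℕ, Nonempty (RatCoords G (Fin n))) ∨ Nonempty (RatCoords G ℕ) := by
  let b := Module.Basis.ofSpan (span_range_rationalization (G := G))
  have hb : ∀ i, ∃ g, rationalization G g = b i := fun i =>
    Module.Basis.ofSpan_subset (span_range_rationalization (G := G)) ⟨i, rfl⟩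
  choose z hz using hb
  have hinj : Function.Injective z := fun i j h => b.injective (by rw [← hz, ← hz, h])
  have hcount := hinj.countable
  have key : ∀ {κ : Type} (e : κ ≃ _), RatCoords G κ := fun {κ} e =>
    { φ := fun g i => b.repr (rationalization G g) (e i)
      map_mul := fun x y => by funext i; simp [rationalization_mul]
      finite_support := fun x => by
        have := (b.repr (rationalization G x)).hasFiniteSupport.preimage e.injective.injOn
        exact this
      z := fun i => z (e i)
      φ_z_self := fun i => by simp [hz]
      φ_z_ne := fun i j h => by
        simp only [hz, Module.Basis.repr_self]
        exact Finsupp.single_eq_of_ne (fun h' => h (e.injective h'))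
      finite_ker := fun K hK => by
        refine (hG.finite_isOfFinOrder hK).subset ?_
        rintro k ⟨hk, hk'⟩
        refine ⟨hk, hG.isOfFinOrder_of_rationalization_eq_zero ?_⟩
        rw [← b.repr.map_eq_zero_iff]
        ext i
        have := congrFun hk' (e.symm i)
        simpa using this }
  rcases finite_or_infinite ((linearIndepOn_empty ℚ id).extend
    (Set.empty_subset (Set.range (rationalization G)))) with h | h
  · obtain ⟨n, ⟨e⟩⟩ := Finite.exists_equiv_fin ((linearIndepOn_empty ℚ id).extend
      (Set.empty_subset (Set.range (rationalization G))))
    exact Or.inl ⟨n, ⟨key e.symm⟩⟩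
  · obtain ⟨e⟩ := nonempty_equiv_of_countable (α := ℕ) (β := (linearIndepOn_empty ℚ id).extend
      (Set.empty_subset (Set.range (rationalization G))))
    exact Or.inr ⟨key e⟩
end

/-! ### Finiteness in terms of coordinates -/

namespace RatCoords
variable {G : Type*} [Group G] {ι : Type*} (c : RatCoords G ι)

/-- The coordinates as a group homomorphism. -/
def hom : G →* Multiplicative (ι → ℚ) where
  toFun x := Multiplicative.ofAdd (c.φ x)
  map_one' := by
    have := c.map_mul 1 1
    rw [one_mul, left_eq_add] at this
    rw [this]; rfl
  map_mul' x y := by rw [c.map_mul]; rfl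

theorem φ_one : c.φ 1 = 0 := congrArg Multiplicative.toAdd c.hom.map_one

theorem φ_inv (x : G) : c.φ x⁻¹ = -c.φ x := congrArg Multiplicative.toAdd (c.hom.map_inv x)

theorem φ_zpow (x : G) (n : ℤ) : c.φ (x ^ n) = n • c.φ x :=
  congrArg Multiplicative.toAdd (c.hom.map_zpow x n)

theorem φ_mul_apply (x y : G) (i : ι) : c.φ (x * y) i = c.φ x i + c.φ y i := by
  rw [c.map_mul]; rfl

theorem φ_inv_apply (x : G) (i : ι) : c.φ x⁻¹ i = -c.φ x i := by
  rw [c.φ_inv]; rfl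

theorem φ_inv_mul (x y : G) (i : ι) : c.φ (x⁻¹ * y) i = c.φ y i - c.φ x i := by
  rw [c.φ_mul_apply, c.φ_inv_apply]; ring

open Classical in
theorem exists_mem_φ_eq {K : Subgroup G} (S : Finset ι) (hS : ∀ j ∈ S, c.z j ∈ K) (a : ι → ℤ) :
    ∃ k ∈ K, ∀ j, c.φ k j = if j ∈ S then (a j : ℚ) else 0 := by
  induction S using Finset.induction_on with
  | empty => exact ⟨1, K.one_mem, fun j => by simp [c.φ_one]⟩
  | insert i S hi ih =>
    obtain ⟨k, hk, hk'⟩ := ih fun j hj => hS j (Finset.mem_insert_of_mem hj)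
    refine ⟨c.z i ^ a i * k,
      K.mul_mem (K.zpow_mem (hS i (Finset.mem_insert_self i S)) _) hk, fun j => ?_⟩
    rw [c.φ_mul_apply, hk', c.φ_zpow]
    by_cases hj : j = i
    · subst hj; simp [hi, c.φ_z_self]
    · simp [hj, c.φ_z_ne i j hj]

theorem exists_mem_φ_near {K : Subgroup G} (S : Finset ι) (hS : ∀ j ∈ S, c.z j ∈ K)
    (v : ι → ℚ) : ∃ k ∈ K, (∀ j ∈ S, |c.φ k j - v j| ≤ 1) ∧ ∀ j ∉ S, c.φ k j = 0 := by
  obtain ⟨k, hk, h⟩ := c.exists_mem_φ_eq S hS fun j => ⌊v j⌋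
  refine ⟨k, hk, fun j hj => ?_, fun j hj => by simp [h, hj]⟩
  have h1 := Int.floor_le (v j)
  have h2 := Int.lt_floor_add_one (v j)
  rw [h, if_pos hj, abs_le]
  constructor <;> linarith

theorem finite_fibre {K : Subgroup G} (hK : K.FG) (v : ι → ℚ) :
    {k | k ∈ K ∧ c.φ k = v}.Finite := by
  rcases Set.eq_empty_or_nonempty {k | k ∈ K ∧ c.φ k = v} with h | ⟨k, hk, hk'⟩
  · rw [h]; exact Set.finite_empty
  · refine ((c.finite_ker K hK).image (k * ·)).subset ?_
    rintro l ⟨hl, hl'⟩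
    refine ⟨k⁻¹ * l, ⟨K.mul_mem (K.inv_mem hk) hl, ?_⟩, by simp⟩
    rw [c.map_mul, c.φ_inv, hk', hl', neg_add_cancel]

theorem exists_denominator {K : Subgroup G} (hK : K.FG) :
    ∃ d : ℕ, 0 < d ∧ ∀ k ∈ K, ∀ i, ∃ n : ℤ, c.φ k i * d = n := by
  have hone : ∀ s : G, ∃ d : ℕ, 0 < d ∧ ∀ i, ∃ n : ℤ, c.φ s i * d = n := by
    intro s
    refine ⟨∏ i ∈ (c.finite_support s).toFinset, (c.φ s i).den,
      Finset.prod_pos fun i _ => (c.φ s i).pos, fun i => ?_⟩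
    by_cases hi : c.φ s i = 0
    · exact ⟨0, by simp [hi]⟩
    · obtain ⟨m, hm⟩ := Finset.dvd_prod_of_mem (fun i => (c.φ s i).den)
        ((c.finite_support s).mem_toFinset.2 hi)
      refine ⟨(c.φ s i).num * m, ?_⟩
      rw [hm]
      push_cast
      rw [← mul_assoc, Rat.mul_den_eq_num]
  choose d hd hd' using hone
  obtain ⟨S, hS⟩ := hK
  refine ⟨∏ s ∈ S, d s, Finset.prod_pos fun s _ => hd s, fun k hk i => ?_⟩
  rw [← hS] at hk
  induction hk using Subgroup.closure_induction with
  | mem x hx =>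
    obtain ⟨m, hm⟩ := Finset.dvd_prod_of_mem d hx
    obtain ⟨n, hn⟩ := hd' x i
    refine ⟨n * m, ?_⟩
    rw [hm]
    push_cast
    rw [← mul_assoc, hn]
  | one => exact ⟨0, by simp [c.φ_one]⟩
  | mul x y _ _ hx hy =>
    obtain ⟨m, hm⟩ := hx
    obtain ⟨n, hn⟩ := hy
    exact ⟨m + n, by rw [c.φ_mul_apply, add_mul, hm, hn]; push_cast; ring⟩
  | inv x _ hx =>
    obtain ⟨m, hm⟩ := hx
    exact ⟨-m, by rw [c.φ_inv_apply, neg_mul, hm]; push_cast; ring⟩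

/-- Coordinates on a finitely generated subgroup have a common denominator, so bounded ones take
finitely many values, and each fibre is empty or a translate of the finite kernel. Every finiteness
claim about differences is reduced to this one. -/
theorem finite_bounded {K : Subgroup G} (hK : K.FG) (S : Finset ι) (C : ℚ) :
    {k | k ∈ K ∧ (∀ i ∈ S, |c.φ k i| ≤ C) ∧ ∀ i ∉ S, c.φ k i = 0}.Finite := by
  classical
  obtain ⟨d, hd, hd'⟩ := c.exists_denominator hK
  have hd0 : (0 : ℚ) < d := by exact_mod_cast hd
  have hT : {q : ℚ | |q| ≤ C ∧ ∃ n : ℤ, q * d = n}.Finite := by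
    refine ((Set.finite_Icc (-⌈C * d⌉) ⌈C * d⌉).image fun n : ℤ => (n : ℚ) / d).subset ?_
    rintro q ⟨hq, n, hn⟩
    refine ⟨n, ?_, by simp only; rw [← hn]; field_simp⟩
    have h1 : |(n : ℚ)| ≤ C * d := by
      rw [← hn, abs_mul, abs_of_pos hd0]; gcongr
    have h2 : |(n : ℚ)| ≤ (⌈C * d⌉ : ℤ) := h1.trans (Int.le_ceil _)
    have h3 : |n| ≤ ⌈C * d⌉ := by exact_mod_cast h2
    exact abs_le.1 h3
  have hW := Set.Finite.pi' (ι := S) fun _ => hT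
  refine (hW.biUnion fun w _ => c.finite_fibre hK fun i => if h : i ∈ S then w ⟨i, h⟩ else 0).subset ?_
  rintro k ⟨hk, hkS, hk0⟩
  simp only [Set.mem_iUnion]
  refine ⟨fun i => c.φ k i, fun i => ⟨hkS i i.2, hd' k hk i⟩, hk, ?_⟩
  funext i
  by_cases hi : i ∈ S
  · simp [hi]
  · simp [hi, hk0 i hi]

theorem exists_abs_φ_le {F : Set G} (hF : F.Finite) (S : Finset ι) :
    ∃ C : ℚ, 0 ≤ C ∧ ∀ g ∈ F, ∀ i ∈ S, |c.φ g i| ≤ C := by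
  obtain ⟨C, hC⟩ := (hF.image fun g => ∑ i ∈ S, |c.φ g i|).bddAbove
  refine ⟨max C 0, le_max_right _ _, fun g hg i hi => le_trans ?_ (le_max_left _ _)⟩
  exact (Finset.single_le_sum (f := fun i => |c.φ g i|) (fun _ _ => abs_nonneg _) hi).trans
    (hC ⟨g, hg, rfl⟩)

end RatCoords

/-! ### Asymptotic dimension equals rank -/

/-- Along consecutive integers, the quotient jumps only on arriving at residue `i`. The integers of
residue `i` thus act as walls between bricks. -/
theorem Int.sub_ediv_eq_of_abs_sub_le_one {m i t t' : ℤ} (hi0 : 0 ≤ i) (him : i < m)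
    (ht : t % m ≠ i) (ht' : t' % m ≠ i) (h : |t - t'| ≤ 1) : (t - i) / m = (t' - i) / m := by
  have hm : 0 < m := by omega
  have key : ∀ s : ℤ, (s + 1) % m ≠ i → (s - i) / m = (s + 1 - i) / m := by
    intro s hs
    have h1 := Int.emod_nonneg (s - i) hm.ne'
    have h2 := Int.emod_lt_of_pos (s - i) hm
    have h3 := Int.mul_ediv_add_emod (s - i) m
    symm
    rw [Int.ediv_eq_iff_of_pos hm]
    refine ⟨by linarith [mul_comm ((s - i) / m) m], ?_⟩
    by_contra hcon
    apply hs
    have h4 : s + 1 = i + m * ((s - i) / m + 1) := by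
      have : (s - i) % m = m - 1 := by
        have : s + 1 - i ≥ m * ((s - i) / m) + m := by linarith [mul_comm ((s - i) / m) m]
        omega
      linarith
    rw [h4, Int.add_mul_emod_self_left, Int.emod_eq_of_lt hi0 him]
  rw [abs_le] at h
  rcases (by omega : t' = t ∨ t' = t + 1 ∨ t = t' + 1) with rfl | rfl | rfl
  · rfl
  · exact key _ ht'
  · exact (key _ ht).symm

theorem abs_floor_sub_floor_le_one {a b : ℚ} (h : |a - b| ≤ 1) : |⌊a⌋ - ⌊b⌋| ≤ 1 := by
  rw [abs_le] at h ⊢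
  have h1 : ⌊a⌋ ≤ ⌊b⌋ + 1 := by
    rw [← Int.floor_add_one]; exact Int.floor_mono (by linarith)
  have h2 : ⌊b⌋ ≤ ⌊a⌋ + 1 := by
    rw [← Int.floor_add_one]; exact Int.floor_mono (by linarith)
  constructor <;> omega

namespace RatCoords
section
variable {G : Type*} [Group G] [Countable G] [MetricSpace G] [ProperSpace G] [IsIsometricSMul G G]

/-- A brick cover: colour `i` discards the slabs where some rescaled coordinate has integer part
congruent to `i` modulo `n + 1`, and cuts the rest along those slabs and the cosets of `K`. A step
of length below `D` stays in its coset and crosses no slab. -/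
theorem asdimLE {n : ℕ} (c : RatCoords G (Fin n)) : AsdimLE G n := by
  intro D _
  have hB : (Metric.closedBall (1 : G) D).Finite := finite_closedBall_of_countable 1 D
  set K : Subgroup G := Subgroup.closure (Metric.closedBall (1 : G) D) with hKdef
  have hK : K.FG := (Subgroup.fg_iff K).2 ⟨_, rfl, hB⟩
  obtain ⟨C, hC0, hC⟩ := c.exists_abs_φ_le hB Finset.univ
  -- A step in the `D`-ball changes each coordinate by at most `C`, hence its integer part after
  -- division by `L` by at most one.
  set L : ℚ := C + 1
  have hL : 0 < L := by positivity
  let t : G → Fin n → ℤ := fun x k => ⌊c.φ x k / L⌋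
  let U : Fin (n + 1) → (G ⧸ K) × (Fin n → ℤ) → Set G := fun i p =>
    {x | (x : G ⧸ K) = p.1 ∧ ∀ k, t x k % ((n + 1 : ℕ) : ℤ) ≠ (i : ℕ) ∧
      (t x k - (i : ℕ)) / ((n + 1 : ℕ) : ℤ) = p.2 k}
  have hm : (0 : ℤ) < ((n + 1 : ℕ) : ℤ) := by positivity
  refine ⟨fun i => Set.range (U i), ?_, ?_, ?_⟩
  · intro x
    -- The `n` coordinates occupy at most `n` of the `n + 1` residues.
    have : ∃ i : Fin (n + 1), ∀ k, t x k % ((n + 1 : ℕ) : ℤ) ≠ (i : ℕ) := by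
      by_contra! hcon
      choose κ hκ using hcon
      have hinj : Function.Injective κ := by
        intro i j hij
        have := hκ i
        rw [hij, hκ j] at this
        exact Fin.ext (by exact_mod_cast this.symm)
      simpa using Fintype.card_le_of_injective κ hinj
    obtain ⟨i, hi⟩ := this
    exact ⟨i, _, ⟨(x, fun k => (t x k - (i : ℕ)) / ((n + 1 : ℕ) : ℤ)), rfl⟩, rfl,
      fun k => ⟨hi k, rfl⟩⟩
  · obtain ⟨R, hR⟩ := exists_forall_dist_le_of_finite
      (c.finite_bounded hK Finset.univ (((n + 1 : ℕ) + 1 : ℚ) * L))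
    refine ⟨R, ?_⟩
    rintro i _ ⟨⟨q, a⟩, rfl⟩ x hx y hy
    refine hR x y ⟨QuotientGroup.eq.1 (hx.1.trans hy.1.symm), fun k _ => ?_, fun k hk => by simp at hk⟩
    rw [c.φ_inv_mul]
    have hx2 := (Int.ediv_eq_iff_of_pos hm).1 (hx.2 k).2
    have hy2 := (Int.ediv_eq_iff_of_pos hm).1 (hy.2 k).2
    have h1 := Int.floor_le (c.φ x k / L)
    have h2 := Int.lt_floor_add_one (c.φ x k / L)
    have h3 := Int.floor_le (c.φ y k / L)
    have h4 := Int.lt_floor_add_one (c.φ y k / L)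
    have h5 : t x k ≤ t y k + (n + 1 : ℕ) := by linarith [hx2.2, hy2.1]
    have h6 : t y k ≤ t x k + (n + 1 : ℕ) := by linarith [hx2.1, hy2.2]
    have h5' : (t x k : ℚ) ≤ t y k + (n + 1 : ℕ) := by exact_mod_cast h5
    have h6' : (t y k : ℚ) ≤ t x k + (n + 1 : ℕ) := by exact_mod_cast h6
    have h7 : |c.φ y k / L - c.φ x k / L| ≤ (n + 1 : ℕ) + 1 := by
      rw [abs_le]
      constructor <;> linarith
    rw [← sub_div, abs_div, abs_of_pos hL, div_le_iff₀ hL] at h7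
    exact h7
  · rintro i _ ⟨⟨q, a⟩, rfl⟩ _ ⟨⟨q', a'⟩, rfl⟩ hne u hu v hv
    by_contra! hlt
    apply hne
    have hmem : u⁻¹ * v ∈ Metric.closedBall (1 : G) D := inv_mul_mem_closedBall hlt.le
    have hq : q = q' :=
      hu.1.symm.trans ((QuotientGroup.eq.2 (Subgroup.subset_closure hmem)).trans hv.1)
    have ha : a = a' := by
      funext k
      refine (hu.2 k).2.symm.trans (Eq.trans ?_ (hv.2 k).2)
      refine Int.sub_ediv_eq_of_abs_sub_le_one (by positivity) (by exact_mod_cast i.2)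
        (hu.2 k).1 (hv.2 k).1 (abs_floor_sub_floor_le_one ?_)
      rw [abs_sub_comm, ← sub_div, ← c.φ_inv_mul, abs_div, abs_of_pos hL, div_le_one hL]
      have := hC _ hmem k (Finset.mem_univ k)
      linarith
    rw [hq, ha]

/-- A cover with `n + 1` colours, restricted to a lattice of rank `n + 1`, would define for each
colour a set separating a pair of opposite faces of a big cube. Poincaré–Miranda gives a unit cube
on which no indicator is constant, but the colour of its lowest corner has a constant indicator
there. -/
theorem not_asdimLE {ι : Type*} (c : RatCoords G ι) {n : ℕ} (e : Fin (n + 1) ↪ ι) :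
    ¬ AsdimLE G n := by
  classical
  intro hX
  set S : Finset ι := Finset.univ.map e with hS
  set K : Subgroup G := Subgroup.closure (Set.range fun j => c.z (e j)) with hKdef
  have hK : K.FG := (Subgroup.fg_iff K).2 ⟨_, rfl, Set.finite_range _⟩
  have hzK : ∀ j ∈ S, c.z j ∈ K := by
    intro j hj
    obtain ⟨i, -, rfl⟩ := Finset.mem_map.1 hj
    exact Subgroup.subset_closure ⟨i, rfl⟩
  have hs : ∀ a : Fin (n + 1) → ℕ, ∃ k ∈ K, (∀ j, c.φ k (e j) = a j) ∧
      ∀ i ∉ S, c.φ k i = 0 := by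
    intro a
    obtain ⟨k, hk, h⟩ := c.exists_mem_φ_eq S hzK fun i => (Function.extend e a 0 i : ℕ)
    refine ⟨k, hk, fun j => ?_, fun i hi => by rw [h, if_neg hi]⟩
    rw [h, if_pos (Finset.mem_map_of_mem e (Finset.mem_univ j)), e.injective.extend_apply]
    simp
  choose s hsK hs1 hs0 using hs
  obtain ⟨C, hC⟩ := exists_forall_dist_le_of_finite (c.finite_bounded hK S 2)
  have hdist : ∀ a b : Fin (n + 1) → ℕ, (∀ j, a j ≤ b j + 2 ∧ b j ≤ a j + 2) →
      dist (s a) (s b) ≤ C := by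
    intro a b hab
    refine hC _ _ ⟨K.mul_mem (K.inv_mem (hsK a)) (hsK b), fun i hi => ?_, fun i hi => ?_⟩
    · obtain ⟨j, -, rfl⟩ := Finset.mem_map.1 hi
      rw [c.φ_inv_mul, hs1, hs1, abs_le]
      have h1 : (a j : ℚ) ≤ b j + 2 := by exact_mod_cast (hab j).1
      have h2 : (b j : ℚ) ≤ a j + 2 := by exact_mod_cast (hab j).2
      constructor <;> linarith
    · rw [c.φ_inv_mul, hs0 a i hi, hs0 b i hi, sub_zero]
  -- Discreteness beyond `C` forces two members of one colour to coincide if they contain lattice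
  -- points differing by at most `2` in each coordinate.
  obtain ⟨𝓤, hcov, ⟨R, hR⟩, hdisc⟩ := hX (max C 0 + 1) (by positivity)
  obtain ⟨W', -, hW'⟩ := c.exists_abs_φ_le (finite_closedBall_of_countable (1 : G) R) S
  obtain ⟨W, hW⟩ := exists_nat_ge W'
  have hbound : ∀ i, ∀ U ∈ 𝓤 i, ∀ a b, s a ∈ U → s b ∈ U → a i ≤ b i + W := by
    intro i U hU a b ha hb
    have h1 := hW' _ (inv_mul_mem_closedBall (hR i U hU _ hb _ ha)) (e i)
      (Finset.mem_map_of_mem e (Finset.mem_univ i))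
    rw [c.φ_inv_mul, hs1, hs1, abs_le] at h1
    have h2 : (a i : ℚ) ≤ b i + W := by linarith [h1.2]
    exact_mod_cast h2
  let near : (Fin (n + 1) → ℕ) → (Fin (n + 1) → ℕ) → Prop := fun a b =>
    ∀ j, a j ≤ b j + 1 ∧ b j ≤ a j + 1
  -- Members have extent at most `W` in direction `i`. One reaching height `W + 2` thus has no point
  -- of height at most `1`, so it is not near the face of height `0`.
  let high : Fin (n + 1) → Set G → Prop := fun i U => ∃ b, s b ∈ U ∧ W + 2 ≤ b i
  let P : Fin (n + 1) → (Fin (n + 1) → ℕ) → Prop := fun i a =>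
    a i = W + 3 ∨ ∃ U ∈ 𝓤 i, high i U ∧ ∃ b, near a b ∧ s b ∈ U
  have hface : ∀ i a, a i = 0 → ¬ P i a := by
    rintro i a ha (h | ⟨V, hV, ⟨b', hb', hb''⟩, b, hb, hbV⟩)
    · omega
    · have := hbound i V hV b' b hb' hbV
      have := hb i
      omega
  obtain ⟨x, hx⟩ := exists_cube_forall_not_constant (N := W + 3)
    (h := fun i a => if P i a then 1 else 0) (fun i a ha => if_neg (hface i a ha))
    (fun i a ha => if_pos (Or.inl ha))
  obtain ⟨i, U, hU, hxU⟩ := hcov (s x)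
  obtain ⟨y, y', hy, hy', hne⟩ := hx i
  apply hne
  have key : ∀ y, (∀ j, x j ≤ y j ∧ y j ≤ x j + 1) → (P i y ↔ high i U) := by
    intro y hy
    constructor
    · rintro (h | ⟨V, hV, hVh, b, hb, hbV⟩)
      -- If `y` is on the top face `W + 3`, then `x` has height at least `W + 2`, so `U` is itself
      -- high.
      · exact ⟨x, hxU, by have := hy i; omega⟩
      · have hVU : V = U := by
          by_contra hVU
          have h1 := hdisc i V hV U hU hVU _ hbV _ hxU
          have h2 := hdist b x fun j => by have := hb j; have := hy j; omega
          have := le_max_left C 0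
          linarith
        exact hVU ▸ hVh
    · intro h
      exact Or.inr ⟨U, hU, h, x, fun j => by have := hy j; omega, hxU⟩
  simp only [key y hy, key y' hy']

theorem asdim_eq {n : ℕ} (c : RatCoords G (Fin n)) : asdim G = n :=
  asdim_eq_coe c.asdimLE fun k hk => by
    by_contra! h
    exact c.not_asdimLE (Fin.castLEEmb h) hk

theorem asdim_eq_top (c : RatCoords G ℕ) : asdim G = ⊤ :=
  _root_.asdim_eq_top fun _ => c.not_asdimLE Fin.valEmbedding
end
end RatCoords

/-! ### Coset representatives and enumerations of cosets -/

theorem Subgroup.exists_subset_of_monotone {G : Type*} [Group G] {K : ℕ → Subgroup G}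
    (hK : Monotone K) (hex : ∀ g, ∃ i, g ∈ K i) {F : Set G} (hF : F.Finite) :
    ∃ i, F ⊆ K i := by
  induction F, hF using Set.Finite.induction_on with
  | empty => exact ⟨0, Set.empty_subset _⟩
  | insert _ _ ih =>
    rename_i a s _ _
    obtain ⟨i, hi⟩ := ih
    obtain ⟨j, hj⟩ := hex a
    refine ⟨max i j, Set.insert_subset (hK (le_max_right _ _) hj) (hi.trans ?_)⟩
    exact hK (le_max_left _ _)

theorem Set.Finite.exists_bijOn_Iio {α : Type*} {T : Set α} (hT : T.Finite) {t : α}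
    (ht : t ∈ T) : ∃ (D : ℕ) (f : α → ℕ), Set.BijOn f T (Set.Iio D) ∧ f t = 0 := by
  classical
  obtain ⟨D, ⟨e⟩⟩ := @Finite.exists_equiv_fin T hT
  have hD : 0 < D := Fin.pos (e ⟨t, ht⟩)
  let e' : T ≃ Fin D := e.trans (Equiv.swap (e ⟨t, ht⟩) ⟨0, hD⟩)
  have he' : e' ⟨t, ht⟩ = ⟨0, hD⟩ := by simp [e']
  refine ⟨D, fun a => if h : a ∈ T then e' ⟨a, h⟩ else 0, ⟨?_, ?_, ?_⟩, ?_⟩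
  · intro a ha; simp [ha]
  · intro a ha b hb hab
    simp only [ha, hb, dif_pos] at hab
    simpa using e'.injective (Fin.ext hab)
  · intro n hn
    refine ⟨e'.symm ⟨n, hn⟩, (e'.symm ⟨n, hn⟩).2, by simp⟩
  · simp [ht, he']

namespace RatCoords
variable {G : Type*} [Group G]

/-- Any representative can be corrected by an element of `K` to bring its coordinates in `S` within
`1` of zero; the trivial coset is treated separately so that its representative is exactly `1`. -/
theorem exists_representatives {ι : Type*} (c : RatCoords G ι) {K : Subgroup G} (S : Finset ι)
    (hS : ∀ j ∈ S, c.z j ∈ K) :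
    ∃ r : G → G, (∀ x, (r x)⁻¹ * x ∈ K) ∧ (∀ x y, x⁻¹ * y ∈ K → r x = r y) ∧ r 1 = 1 ∧
      ∀ x, ∀ j ∈ S, |c.φ (r x) j| ≤ 1 := by
  classical
  choose k hk hk1 _ using fun g => c.exists_mem_φ_near S hS (-c.φ g)
  refine ⟨fun x => if (x : G ⧸ K) = ((1 : G) : G ⧸ K) then 1 else
    (x : G ⧸ K).out * k (x : G ⧸ K).out, ?_, ?_, by simp, ?_⟩
  · intro x
    dsimp only
    split_ifs with h
    · rw [← QuotientGroup.eq, h]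
    · rw [← QuotientGroup.eq, QuotientGroup.mk_mul_of_mem _ (hk _)]
      exact Quotient.out_eq' _
  · intro x y h
    simp only [QuotientGroup.eq.2 h]
  · intro x j hj
    dsimp only
    split_ifs with h
    · simp [c.φ_one]
    · rw [c.φ_mul_apply]
      have := hk1 (x : G ⧸ K).out j hj
      rw [Pi.neg_apply, sub_neg_eq_add, add_comm] at this
      exact this

/-- The `i`-th coordinates of `K` have a common denominator and so form a cyclic group; division
with remainder by the least positive value shows that it generates. -/
theorem exists_generator {ι : Type*} (c : RatCoords G ι) {K : Subgroup G} (hK : K.FG) {i : ι}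
    (hi : c.z i ∈ K) : ∃ u ∈ K, 0 < c.φ u i ∧ ∀ k ∈ K, ∃ m : ℤ, c.φ k i = m * c.φ u i := by
  classical
  obtain ⟨d, hd, hd'⟩ := c.exists_denominator hK
  have hd0 : (0 : ℚ) < d := by exact_mod_cast hd
  have hex : ∃ n : ℕ, 0 < n ∧ ∃ u ∈ K, c.φ u i * d = n :=
    ⟨d, hd, c.z i, hi, by rw [c.φ_z_self, one_mul]⟩
  obtain ⟨hpos, u, hu, hun⟩ := Nat.find_spec hex
  set δ := Nat.find hex with hδ
  have hδ0 : (0 : ℚ) < δ := by exact_mod_cast hpos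
  refine ⟨u, hu, ?_, fun k hk => ?_⟩
  · by_contra! h
    have : c.φ u i * d ≤ 0 := mul_nonpos_of_nonpos_of_nonneg h hd0.le
    linarith
  · obtain ⟨n, hn⟩ := hd' k hk i
    have hval : c.φ (u ^ (-(n / δ)) * k) i * d = ((n % δ : ℤ) : ℚ) := by
      rw [c.φ_mul_apply, c.φ_zpow, add_mul, hn, Pi.smul_apply, zsmul_eq_mul, mul_assoc, hun,
        Int.emod_def]
      push_cast
      ring
    have hmod : n % (δ : ℤ) = 0 := by
      by_contra hne
      have h0 : 0 ≤ n % (δ : ℤ) := Int.emod_nonneg _ (by omega)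
      have h1 : n % (δ : ℤ) < δ := Int.emod_lt_of_pos _ (by omega)
      refine Nat.find_min hex (m := (n % (δ : ℤ)).toNat) (by omega) ⟨by omega, _,
        K.mul_mem (K.zpow_mem hu _) hk, hval.trans ?_⟩
      have : (((n % (δ : ℤ)).toNat : ℤ) : ℚ) = ((n % (δ : ℤ) : ℤ) : ℚ) := by
        rw [Int.toNat_of_nonneg h0]
      exact_mod_cast this.symm
    refine ⟨n / δ, ?_⟩
    rw [hmod, Int.cast_zero, c.φ_mul_apply, c.φ_zpow, Pi.smul_apply, zsmul_eq_mul] at hval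
    have := (mul_eq_zero.1 hval).resolve_right hd0.ne'
    push_cast at this
    linarith

/-- Cosets of `K` in `K'` can be enumerated by the integers, at bounded distance from a multiple
of the new coordinate. -/
theorem exists_enumeration (c : RatCoords G ℕ) {i : ℕ} {K K' : Subgroup G} (hK' : K'.FG)
    (hle : K ≤ K') (hz : ∀ j < i, c.z j ∈ K) (hzi : c.z i ∈ K')
    (hs : ∀ k ∈ K, ∀ j, i ≤ j → c.φ k j = 0) (hs' : ∀ k ∈ K', ∀ j, i + 1 ≤ j → c.φ k j = 0) :
    ∃ (e : G → ℤ) (E C : ℚ), 0 < E ∧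
      (∀ x ∈ K', ∀ y ∈ K', (e x = e y ↔ x⁻¹ * y ∈ K)) ∧ (∀ n, ∃ x ∈ K', e x = n) ∧
      e 1 = 0 ∧ ∀ x ∈ K', |e x - E * c.φ x i| ≤ C := by
  classical
  obtain ⟨u, hu, hupos, hgen⟩ := c.exists_generator hK' hzi
  obtain ⟨r, hr, -, -, hr1⟩ := c.exists_representatives (K := K) (Finset.range i)
    fun j hj => hz j (Finset.mem_range.1 hj)
  -- Cosets with zero new coordinate are finitely many: each has a representative with bounded old
  -- coordinates.
  set T : Set (G ⧸ K) := (fun x : G => (x : G ⧸ K)) '' {x | x ∈ K' ∧ c.φ x i = 0} with hTdef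
  have hT : T.Finite := by
    refine ((c.finite_bounded hK' (Finset.range i) 1).image fun x : G => (x : G ⧸ K)).subset ?_
    rintro _ ⟨x, ⟨hx, hxi⟩, rfl⟩
    have hrx : r x ∈ K' := by
      have := K'.mul_mem hx (K'.inv_mem (hle (hr x)))
      simpa using this
    refine ⟨r x, ⟨hrx, hr1 x, fun j hj => ?_⟩, QuotientGroup.eq.2 (hr x)⟩
    rw [Finset.mem_range, not_lt] at hj
    rcases hj.eq_or_lt with rfl | hj
    · have := hs _ (hr x) _ le_rfl
      rw [c.φ_inv_mul, hxi] at this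
      linarith
    · exact hs' _ hrx _ hj
  have h1T : ((1 : G) : G ⧸ K) ∈ T := ⟨1, ⟨K'.one_mem, by rw [c.φ_one]; rfl⟩, rfl⟩
  obtain ⟨D, idx, hbij, hidx1⟩ := hT.exists_bijOn_Iio h1T
  have hD : 0 < D := lt_of_le_of_lt (Nat.zero_le _) (hbij.mapsTo h1T)
  have hD' : (0 : ℤ) < D := by exact_mod_cast hD
  have hm : ∀ x : G, ∃ m : ℤ, x ∈ K' → c.φ x i = m * c.φ u i := fun x => by
    by_cases hx : x ∈ K'
    · obtain ⟨m, h⟩ := hgen x hx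
      exact ⟨m, fun _ => h⟩
    · exact ⟨0, fun h => absurd h hx⟩
  choose m hm using hm
  have hmu : ∀ x ∈ K', ∀ n : ℤ, c.φ x i = n * c.φ u i → m x = n := by
    intro x hx n hn
    rw [hm x hx] at hn
    exact_mod_cast mul_right_cancel₀ hupos.ne' hn
  have hm1 : m 1 = 0 := hmu 1 K'.one_mem 0 (by simp [c.φ_one])
  have hBT : ∀ x ∈ K', ((u ^ (-m x) * x : G) : G ⧸ K) ∈ T := by
    intro x hx
    refine ⟨_, ⟨K'.mul_mem (K'.zpow_mem hu _) hx, ?_⟩, rfl⟩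
    rw [c.φ_mul_apply, c.φ_zpow, Pi.smul_apply, zsmul_eq_mul, hm x hx]
    push_cast
    ring
  -- Divide out the power of `u` carrying the new coordinate; the remaining coset lies in `T`, whose
  -- `D` members serve as base-`D` digits. The factor `D / c.φ u i` is the resulting slope.
  refine ⟨fun x => D * m x + idx ((u ^ (-m x) * x : G) : G ⧸ K), D / c.φ u i, D,
    by positivity, ?_, ?_, ?_, ?_⟩
  · intro x hx y hy
    constructor
    · intro h
      have hxD : (idx ((u ^ (-m x) * x : G) : G ⧸ K) : ℤ) < D := by
        exact_mod_cast hbij.mapsTo (hBT x hx)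
      have hyD : (idx ((u ^ (-m y) * y : G) : G ⧸ K) : ℤ) < D := by
        exact_mod_cast hbij.mapsTo (hBT y hy)
      have hmm : m x = m y := by
        have h1 := congrArg (· / (D : ℤ)) h
        simp only at h1
        rwa [Int.mul_add_ediv_left _ _ hD'.ne', Int.mul_add_ediv_left _ _ hD'.ne',
          Int.ediv_eq_zero_of_lt (by positivity) hxD, Int.ediv_eq_zero_of_lt (by positivity) hyD,
          add_zero, add_zero] at h1
      simp only [hmm, add_right_inj, Nat.cast_inj] at h
      have h2 := QuotientGroup.eq.1 (hbij.injOn (by rw [← hmm]; exact hBT x hx) (hBT y hy) h)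
      simpa [mul_assoc] using h2
    · intro h
      have hmm : m x = m y := by
        refine (hmu y hy _ ?_).symm
        have := hs _ h i le_rfl
        rw [c.φ_inv_mul, hm x hx] at this
        linarith
      have : ((u ^ (-m y) * x : G) : G ⧸ K) = ((u ^ (-m y) * y : G) : G ⧸ K) :=
        QuotientGroup.eq.2 (by simpa [mul_assoc] using h)
      simp only [hmm, this]
  · intro n
    obtain ⟨_, ⟨b, ⟨hb, hb0⟩, rfl⟩, hbn⟩ := hbij.surjOn
      (show (n % D).toNat ∈ Set.Iio D by
        have := Int.emod_nonneg n hD'.ne'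
        have := Int.emod_lt_of_pos n hD'
        simp only [Set.mem_Iio]; omega)
    have hx : u ^ (n / D) * b ∈ K' := K'.mul_mem (K'.zpow_mem hu _) hb
    have hmx : m (u ^ (n / D) * b) = n / D := by
      refine hmu _ hx _ ?_
      rw [c.φ_mul_apply, c.φ_zpow, Pi.smul_apply, zsmul_eq_mul, hb0, add_zero]
    refine ⟨_, hx, ?_⟩
    simp only [hmx]
    rw [← mul_assoc, ← zpow_add, neg_add_cancel, zpow_zero, one_mul, hbn,
      Int.toNat_of_nonneg (Int.emod_nonneg n hD'.ne')]
    exact Int.mul_ediv_add_emod n D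
  · simp [hm1, hidx1]
  · intro x hx
    have h1 : (idx ((u ^ (-m x) * x : G) : G ⧸ K) : ℚ) ≤ D := by
      exact_mod_cast (hbij.mapsTo (hBT x hx)).le
    have h2 : (D : ℚ) / c.φ u i * c.φ x i = D * m x := by
      rw [hm x hx]; field_simp
    rw [h2]
    push_cast
    rw [add_sub_cancel_left, abs_of_nonneg (by positivity)]
    exact h1

end RatCoords

/-! ### Infinite rank: comparison with a direct sum of copies of the integers -/

theorem FinitelyControlled.of_surjective_pair {G H M : Type*} [Group G] [Group H] [Group M]
    {f : G → M} {f' : H → M} (h1 : FinitelyControlled f) (h2 : FinitelyProper f)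
    (h1' : FinitelyControlled f') (h2' : FinitelyProper f') (hs : Function.Surjective f)
    (hs' : Function.Surjective f') :
    ∃ (g : G → H) (F : Set H), FinitelyControlled g ∧ FinitelyProper g ∧ F.Finite ∧
      ∀ y, ∃ x, (g x)⁻¹ * y ∈ F := by
  choose s hs' using hs'
  obtain ⟨F, hF, hF'⟩ := h2' {1} (Set.finite_singleton 1)
  refine ⟨fun x => s (f x), F, fun A hA => ?_, fun A hA => ?_, hF, fun y => ?_⟩
  · obtain ⟨B, hB, hB'⟩ := h1 A hA
    obtain ⟨C, hC, hC'⟩ := h2' B hB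
    exact ⟨C, hC, fun x y h => hC' _ _ (by rw [hs', hs']; exact hB' x y h)⟩
  · obtain ⟨B, hB, hB'⟩ := h1' A hA
    obtain ⟨C, hC, hC'⟩ := h2 B hB
    refine ⟨C, hC, fun x y h => hC' _ _ ?_⟩
    have := hB' _ _ h
    rwa [hs', hs'] at this
  · obtain ⟨x, hx⟩ := hs (f' y)
    exact ⟨x, hF' _ _ (by rw [hs', hx]; simp)⟩

theorem Finsupp.finite_bounded_int (i : ℕ) (M : ℤ) :
    {w : ℕ →₀ ℤ | (∀ j, i ≤ j → w j = 0) ∧ ∀ j < i, |w j| ≤ M}.Finite := by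
  have hW := Set.Finite.pi' (ι := Fin i) fun _ => Set.finite_Icc (-M) M
  refine Set.Finite.of_finite_image (f := fun (w : ℕ →₀ ℤ) (j : Fin i) => w j)
    (hW.subset ?_) ?_
  · rintro _ ⟨w, ⟨-, hw⟩, rfl⟩ j
    exact abs_le.1 (hw j j.2)
  · rintro w ⟨hw, -⟩ w' ⟨hw', -⟩ h
    ext j
    by_cases hj : j < i
    · exact congrFun h ⟨j, hj⟩
    · rw [hw j (not_lt.1 hj), hw' j (not_lt.1 hj)]

theorem Finsupp.exists_bound_of_finite {F : Set (ℕ →₀ ℤ)} (hF : F.Finite) :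
    ∃ (i : ℕ) (M : ℤ), ∀ w ∈ F, (∀ j, i ≤ j → w j = 0) ∧ ∀ j, |w j| ≤ M := by
  induction F, hF using Set.Finite.induction_on with
  | empty => exact ⟨0, 0, by simp⟩
  | insert _ _ ih =>
    rename_i a s _ _
    obtain ⟨i, M, h⟩ := ih
    obtain ⟨i', hi'⟩ := a.support.bddAbove
    refine ⟨max i (i' + 1), max M (∑ j ∈ a.support, |a j|), ?_⟩
    rintro w (rfl | hw)
    · refine ⟨fun j hj => ?_, fun j => ?_⟩
      · by_contra hne
        have := hi' (Finsupp.mem_support_iff.2 hne)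
        have := (le_max_right i (i' + 1)).trans hj
        omega
      · refine le_trans ?_ (le_max_right _ _)
        by_cases hj : w j = 0
        · rw [hj, abs_zero]; positivity
        · exact Finset.single_le_sum (f := fun j => |w j|) (fun _ _ => abs_nonneg _)
            (Finsupp.mem_support_iff.2 hj)
    · exact ⟨fun j hj => (h w hw).1 j ((le_max_left _ _).trans hj),
        fun j => ((h w hw).2 j).trans (le_max_left _ _)⟩

/-- The map to `ℤ^i` built from enumerations `e j` and coset representatives `r j` of the
successive quotients of a tower of subgroups. -/
noncomputable def stageMap {G : Type*} [Group G] (e : ℕ → G → ℤ) (r : ℕ → G → G) :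
    ℕ → G → (ℕ →₀ ℤ)
  | 0, _ => 0
  | i + 1, x => Finsupp.single i (e i x) + stageMap e r i ((r i x)⁻¹ * x)

section
variable {G : Type*} [Group G] {e : ℕ → G → ℤ} {r : ℕ → G → G} {K : ℕ → Subgroup G}

theorem stageMap_apply_of_le : ∀ {i : ℕ} {x : G} {j : ℕ}, i ≤ j → stageMap e r i x j = 0
  | 0, _, _, _ => rfl
  | i + 1, x, j, h => by
    rw [stageMap, Finsupp.add_apply, stageMap_apply_of_le (by omega),
      Finsupp.single_eq_of_ne (by omega), add_zero]

theorem stageMap_succ_self (i : ℕ) (x : G) : stageMap e r (i + 1) x i = e i x := by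
  rw [stageMap, Finsupp.add_apply, stageMap_apply_of_le le_rfl, Finsupp.single_eq_same, add_zero]

theorem stageMap_succ_of_ne {i j : ℕ} (h : j ≠ i) (x : G) :
    stageMap e r (i + 1) x j = stageMap e r i ((r i x)⁻¹ * x) j := by
  rw [stageMap, Finsupp.add_apply, Finsupp.single_eq_of_ne h, zero_add]

variable (hmono : Monotone K) (hr : ∀ i x, (r i x)⁻¹ * x ∈ K i)
  (hrr : ∀ i x y, x⁻¹ * y ∈ K i → r i x = r i y) (hr1 : ∀ i, r i 1 = 1)
  (he : ∀ i, ∀ x ∈ K (i + 1), ∀ y ∈ K (i + 1), (e i x = e i y ↔ x⁻¹ * y ∈ K i))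
  (hes : ∀ i n, ∃ x ∈ K (i + 1), e i x = n) (he1 : ∀ i, e i 1 = 0)

include hmono hrr hr1 he he1 in
-- On a smaller subgroup the higher enumerations and representatives are trivial, because `e` and
-- `r` are normalized at `1`. The stages therefore glue to one map on the union.
theorem stageMap_eq_of_mem {i N : ℕ} (h : i ≤ N) {x : G} (hx : x ∈ K i) :
    stageMap e r N x = stageMap e r i x := by
  induction N, h using Nat.le_induction with
  | base => rfl
  | succ N hN ih =>
    have hxN : (1 : G)⁻¹ * x ∈ K N := by simpa using hmono hN hx
    rw [stageMap, ← (he N 1 (K _).one_mem x (hmono (by omega) hx)).2 hxN, he1,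
      ← hrr N 1 x hxN, hr1]
    simpa using ih

include hmono hr hrr he in
-- Points in one coset of `K i` share all higher enumerations and representatives, which cancel in
-- the difference. Only a left translate inside `K i` remains, so estimates at stage `i` are uniform
-- over the group.
theorem exists_stageMap_sub_eq {i N : ℕ} (h : i ≤ N) {x : G} (hx : x ∈ K N) :
    ∃ x' ∈ K i, ∀ k ∈ K i, stageMap e r N (x * k) - stageMap e r N x =
      stageMap e r i (x' * k) - stageMap e r i x' := by
  induction N, h using Nat.le_induction generalizing x with
  | base => exact ⟨x, hx, fun _ _ => rfl⟩
  | succ N hN ih =>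
    obtain ⟨x', hx', h'⟩ := ih (hr N x)
    refine ⟨x', hx', fun k hk => ?_⟩
    have hk' : x⁻¹ * (x * k) ∈ K N := by simpa using hmono hN hk
    rw [stageMap, stageMap, ← hrr N x (x * k) hk',
      ← (he N x hx _ ((K _).mul_mem hx (hmono (by omega) hk))).2 hk', ← h' k hk, mul_assoc]
    abel

include hr hrr he in
theorem inv_mul_mem_of_stageMap_eq {i N : ℕ} (h : i ≤ N) {x y : G} (hx : x ∈ K N)
    (hy : y ∈ K N) (hxy : ∀ j, i ≤ j → stageMap e r N x j = stageMap e r N y j) :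
    x⁻¹ * y ∈ K i := by
  induction N, h using Nat.le_induction generalizing x y with
  | base => exact (K _).mul_mem ((K _).inv_mem hx) hy
  | succ N hN ih =>
    have h1 := hxy N hN
    rw [stageMap_succ_self, stageMap_succ_self, he N x hx y hy] at h1
    have h2 := ih (hr N x) (hr N y) fun j hj => by
      by_cases hjN : j = N
      · rw [stageMap_apply_of_le hjN.ge, stageMap_apply_of_le hjN.ge]
      · rw [← stageMap_succ_of_ne hjN, ← stageMap_succ_of_ne hjN, hxy j hj]
    rw [← hrr N x y h1] at h2
    simpa [mul_assoc] using h2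

include hmono hr hrr he hes in
theorem exists_stageMap_eq (N : ℕ) {v : ℕ →₀ ℤ} (hv : ∀ j, N ≤ j → v j = 0) :
    ∃ x ∈ K N, stageMap e r N x = v := by
  induction N generalizing v with
  | zero =>
    refine ⟨1, (K 0).one_mem, ?_⟩
    ext j
    rw [hv j (Nat.zero_le _)]; rfl
  | succ N ih =>
    obtain ⟨y, hy, hyv⟩ := hes N (v N)
    obtain ⟨x', hx', hxv⟩ := ih (v := v.erase N) fun j hj => by
      by_cases hjN : j = N
      · rw [hjN, Finsupp.erase_same]
      · rw [Finsupp.erase_ne hjN, hv j (by omega)]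
    have hrK : r N y ∈ K (N + 1) := by
      have := (K (N + 1)).mul_mem hy ((K (N + 1)).inv_mem (hmono N.le_succ (hr N y)))
      simpa using this
    have hx : r N y * x' ∈ K (N + 1) := (K _).mul_mem hrK (hmono N.le_succ hx')
    have hxy : (r N y * x')⁻¹ * y ∈ K N := by
      have := (K N).mul_mem ((K N).inv_mem hx') (hr N y)
      simpa [mul_assoc] using this
    refine ⟨_, hx, ?_⟩
    rw [stageMap, hrr N _ y hxy, (he N _ hx y hy).2 hxy, hyv, inv_mul_cancel_left, hxv,
      Finsupp.single_add_erase]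
end

namespace RatCoords
variable {G : Type*} [Group G]

/-- Each enumeration is nearly linear in its own coordinate, and passing to a lower stage shifts the
other coordinates by those of a representative, which are bounded by `1`. -/
theorem abs_stageMap_sub_le (c : RatCoords G ℕ) {e : ℕ → G → ℤ} {r : ℕ → G → G}
    {K : ℕ → Subgroup G} {E C : ℕ → ℚ} (hE : ∀ i, 0 < E i) (hr : ∀ i x, (r i x)⁻¹ * x ∈ K i)
    (hr1 : ∀ i x, ∀ j < i, |c.φ (r i x) j| ≤ 1)
    (heC : ∀ i, ∀ x ∈ K (i + 1), |e i x - E i * c.φ x i| ≤ C i) (i : ℕ) :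
    ∃ B : ℚ, 0 ≤ B ∧ ∀ x ∈ K i, ∀ j < i, |stageMap e r i x j - E j * c.φ x j| ≤ B := by
  induction i with
  | zero => exact ⟨0, le_rfl, fun _ _ j hj => absurd hj (Nat.not_lt_zero j)⟩
  | succ i ih =>
    obtain ⟨B, hB0, hB⟩ := ih
    have hsum : 0 ≤ ∑ j ∈ Finset.range i, E j := Finset.sum_nonneg fun j _ => (hE j).le
    refine ⟨|C i| + (B + ∑ j ∈ Finset.range i, E j), by positivity, fun x hx j hj => ?_⟩
    rcases Nat.lt_succ_iff_lt_or_eq.1 hj with hj | rfl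
    · rw [stageMap_succ_of_ne hj.ne]
      have h1 := hB _ (hr i x) j hj
      have h2 := hr1 i x j hj
      have h3 : E j ≤ ∑ j ∈ Finset.range i, E j :=
        Finset.single_le_sum (fun j _ => (hE j).le) (Finset.mem_range.2 hj)
      have h4 : |E j * c.φ (r i x) j| ≤ E j := by
        rw [abs_mul, abs_of_pos (hE j)]
        exact mul_le_of_le_one_right (hE j).le h2
      rw [c.φ_inv_mul] at h1
      rw [abs_le] at h1 h4 ⊢
      have := abs_nonneg (C i)
      constructor <;> linarith
    · rw [stageMap_succ_self]
      exact (heC j x hx).trans ((le_abs_self _).trans (le_add_of_nonneg_right (by positivity)))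

/-- `K i` is generated by the first `i` unit elements and those of the first `i` group elements
whose coordinates vanish from `i` on. Finite supports make this exhaust `G`. -/
theorem exists_tower [Countable G] (c : RatCoords G ℕ) :
    ∃ K : ℕ → Subgroup G, Monotone K ∧ (∀ g, ∃ i, g ∈ K i) ∧ (∀ i, (K i).FG) ∧
      (∀ i, ∀ j < i, c.z j ∈ K i) ∧ ∀ i, ∀ k ∈ K i, ∀ j, i ≤ j → c.φ k j = 0 := by
  obtain ⟨g, hg⟩ := exists_surjective_nat G
  let S : ℕ → Set G := fun i => {x | ∃ j < i, x = c.z j} ∪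
    {x | ∃ j < i, x = g j ∧ ∀ l, i ≤ l → c.φ x l = 0}
  refine ⟨fun i => Subgroup.closure (S i), ?_, ?_, ?_, ?_, ?_⟩
  · intro i i' h
    refine Subgroup.closure_mono ?_
    rintro x (⟨j, hj, rfl⟩ | ⟨j, hj, rfl, hx⟩)
    · exact Or.inl ⟨j, by omega, rfl⟩
    · exact Or.inr ⟨j, by omega, rfl, fun l hl => hx l (h.trans hl)⟩
  · intro x
    obtain ⟨n, rfl⟩ := hg x
    obtain ⟨M, hM⟩ := (c.finite_support (g n)).bddAbove
    refine ⟨max (n + 1) (M + 1), Subgroup.subset_closure (Or.inr ⟨n, by simp, rfl, ?_⟩)⟩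
    intro l hl
    by_contra hne
    have := hM hne
    have := (le_max_right (n + 1) (M + 1)).trans hl
    omega
  · intro i
    refine (Subgroup.fg_iff _).2 ⟨_, rfl, Set.Finite.union ?_ ?_⟩
    · refine ((Set.finite_Iio i).image c.z).subset ?_
      rintro x ⟨j, hj, rfl⟩
      exact ⟨j, hj, rfl⟩
    · refine ((Set.finite_Iio i).image g).subset ?_
      rintro x ⟨j, hj, rfl, -⟩
      exact ⟨j, hj, rfl⟩
  · intro i j hj
    exact Subgroup.subset_closure (Or.inl ⟨j, hj, rfl⟩)
  · intro i k hk j hj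
    induction hk using Subgroup.closure_induction with
    | mem x hx =>
      rcases hx with ⟨l, hl, rfl⟩ | ⟨l, hl, rfl, hx⟩
      · exact c.φ_z_ne _ _ (by omega)
      · exact hx j hj
    | one => rw [c.φ_one]; rfl
    | mul x y _ _ hx hy => rw [c.φ_mul_apply, hx, hy, add_zero]
    | inv x _ hx => rw [c.φ_inv_apply, hx, neg_zero]

/-- A group of infinite rank is coarsely a direct sum of infinitely many copies of `ℤ`. -/
theorem exists_surjective_finsupp [Countable G] (c : RatCoords G ℕ) :
    ∃ f : G → Multiplicative (ℕ →₀ ℤ), FinitelyControlled f ∧ FinitelyProper f ∧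
      Function.Surjective f := by
  obtain ⟨K, hmono, hex, hfg, hz, hs⟩ := c.exists_tower
  choose r hr hrr hr1 hrb using fun i => c.exists_representatives (K := K i) (Finset.range i)
    fun j hj => hz i j (Finset.mem_range.1 hj)
  replace hrb : ∀ i x, ∀ j < i, |c.φ (r i x) j| ≤ 1 := fun i x j hj =>
    hrb i x j (Finset.mem_range.2 hj)
  choose e E C hE he hes he1 heC using fun i => c.exists_enumeration (hfg (i + 1))
    (hmono i.le_succ) (hz i) (hz (i + 1) i i.lt_succ_self) (hs i) (hs (i + 1))
  choose n hn using hex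
  have hf : ∀ x N, x ∈ K N → stageMap e r (n x) x = stageMap e r N x := fun x N hx => by
    rw [← stageMap_eq_of_mem hmono hrr hr1 he he1 (le_max_left (n x) N) (hn x),
      ← stageMap_eq_of_mem hmono hrr hr1 he he1 (le_max_right (n x) N) hx]
  have hcommon : ∀ i x y, ∃ N, i ≤ N ∧ x ∈ K N ∧ y ∈ K N := fun i x y =>
    ⟨max i (max (n x) (n y)), le_max_left _ _,
      hmono ((le_max_left _ _).trans (le_max_right _ _)) (hn x),
      hmono ((le_max_right _ _).trans (le_max_right _ _)) (hn y)⟩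
  refine ⟨fun x => Multiplicative.ofAdd (stageMap e r (n x) x), ?_, ?_, ?_⟩
  · intro F hF
    obtain ⟨i, hi⟩ := Subgroup.exists_subset_of_monotone hmono (fun g => ⟨n g, hn g⟩) hF
    obtain ⟨B, hB0, hB⟩ := c.abs_stageMap_sub_le hE hr hrb heC i
    obtain ⟨A, hA0, hA⟩ := c.exists_abs_φ_le hF (Finset.range i)
    have hsum : 0 ≤ ∑ j ∈ Finset.range i, E j := Finset.sum_nonneg fun j _ => (hE j).le
    refine ⟨Multiplicative.toAdd ⁻¹' {w : ℕ →₀ ℤ | (∀ j, i ≤ j → w j = 0) ∧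
      ∀ j < i, |w j| ≤ ⌈2 * B + (∑ j ∈ Finset.range i, E j) * A⌉},
      (Finsupp.finite_bounded_int i _).preimage Multiplicative.toAdd.injective.injOn,
      fun x y hxy => ?_⟩
    obtain ⟨N, hN, hx, hy⟩ := hcommon i x y
    obtain ⟨x', hx', h⟩ := exists_stageMap_sub_eq hmono hr hrr he hN hx
    have h := h _ (hi hxy)
    rw [mul_inv_cancel_left] at h
    rw [Set.mem_preimage, toAdd_mul, toAdd_inv, toAdd_ofAdd, toAdd_ofAdd, hf x N hx, hf y N hy,
      neg_add_eq_sub, h]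
    refine ⟨fun j hj => by
      rw [Finsupp.sub_apply, stageMap_apply_of_le hj, stageMap_apply_of_le hj, sub_zero],
      fun j hj => ?_⟩
    have h1 := hB _ hx' j hj
    have h2 := hB _ ((K i).mul_mem hx' (hi hxy)) j hj
    have h3 : |E j * c.φ (x⁻¹ * y) j| ≤ (∑ j ∈ Finset.range i, E j) * A := by
      rw [abs_mul, abs_of_pos (hE j)]
      exact mul_le_mul (Finset.single_le_sum (fun j _ => (hE j).le) (Finset.mem_range.2 hj))
        (hA _ hxy j (Finset.mem_range.2 hj)) (abs_nonneg _) hsum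
    rw [c.φ_mul_apply] at h2
    -- Two errors `B` from near-linearity, plus the scaled coordinate of `x⁻¹ * y`.
    have h4 : |((stageMap e r i (x' * (x⁻¹ * y)) - stageMap e r i x') j : ℚ)| ≤
        2 * B + (∑ j ∈ Finset.range i, E j) * A := by
      rw [Finsupp.sub_apply]
      push_cast
      rw [abs_le] at h1 h2 h3 ⊢
      constructor <;> linarith
    have h5 := h4.trans (Int.le_ceil _)
    exact_mod_cast h5
  · intro F hF
    obtain ⟨i, M, hi⟩ := Finsupp.exists_bound_of_finite
      (F := Multiplicative.ofAdd ⁻¹' F) (hF.preimage Multiplicative.ofAdd.injective.injOn)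
    obtain ⟨B, hB0, hB⟩ := c.abs_stageMap_sub_le hE hr hrb heC i
    refine ⟨_, c.finite_bounded (hfg i) (Finset.range i)
      (∑ j ∈ Finset.range i, (2 * B + |(M : ℚ)|) / E j), fun x y hxy => ?_⟩
    obtain ⟨N, hN, hx, hy⟩ := hcommon i x y
    have hw := hi (stageMap e r N y - stageMap e r N x) (by
      rw [← hf x N hx, ← hf y N hy, ← neg_add_eq_sub]
      exact hxy)
    have hk : x⁻¹ * y ∈ K i := inv_mul_mem_of_stageMap_eq hr hrr he hN hx hy fun j hj => by
      have := hw.1 j hj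
      rw [Finsupp.sub_apply] at this
      omega
    refine ⟨hk, fun j hj => ?_, fun j hj => hs i _ hk j (by simpa using hj)⟩
    rw [Finset.mem_range] at hj
    obtain ⟨x', hx', h⟩ := exists_stageMap_sub_eq hmono hr hrr he hN hx
    have h := h _ hk
    rw [mul_inv_cancel_left] at h
    have h0 := hw.2 j
    rw [h] at h0
    have h0' : |((stageMap e r i (x' * (x⁻¹ * y)) - stageMap e r i x') j : ℚ)| ≤ |(M : ℚ)| := by
      have : |((stageMap e r i (x' * (x⁻¹ * y)) - stageMap e r i x') j : ℚ)| ≤ (M : ℚ) := by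
        exact_mod_cast h0
      exact this.trans (le_abs_self _)
    have h1 := hB _ hx' j hj
    have h2 := hB _ ((K i).mul_mem hx' hk) j hj
    rw [c.φ_mul_apply] at h2
    rw [Finsupp.sub_apply] at h0'
    push_cast at h0'
    have h3 : |E j * c.φ (x⁻¹ * y) j| ≤ 2 * B + |(M : ℚ)| := by
      rw [abs_le] at h0' h1 h2 ⊢
      constructor <;> linarith
    rw [abs_mul, abs_of_pos (hE j), mul_comm, ← le_div_iff₀ (hE j)] at h3
    refine h3.trans (Finset.single_le_sum (f := fun j => (2 * B + |(M : ℚ)|) / E j)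
      (fun j _ => ?_) (Finset.mem_range.2 hj))
    have := hE j
    positivity
  · intro v
    obtain ⟨i, M, hi⟩ := Finsupp.exists_bound_of_finite (Set.finite_singleton v.toAdd)
    obtain ⟨x, hx, hxv⟩ := exists_stageMap_eq hmono hr hrr he hes i (hi _ rfl).1
    refine ⟨x, ?_⟩
    change Multiplicative.ofAdd (stageMap e r (n x) x) = v
    rw [hf x i hx, hxv]
    rfl

end RatCoords

theorem coarselyEquivalent_of_infinite_rank {G H : Type*}
    [Group G] [Countable G] [MetricSpace G] [ProperSpace G] [IsIsometricSMul G G]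
    [Group H] [Countable H] [MetricSpace H] [ProperSpace H] [IsIsometricSMul H H]
    (c : RatCoords G ℕ) (c' : RatCoords H ℕ) : CoarselyEquivalent G H := by
  obtain ⟨f, h1, h2, h3⟩ := c.exists_surjective_finsupp
  obtain ⟨f', h1', h2', h3'⟩ := c'.exists_surjective_finsupp
  obtain ⟨g, F, hg1, hg2, hF, hg3⟩ := h1.of_surjective_pair h2 h1' h2' h3 h3'
  exact coarselyEquivalent_of_finitely hg1 hg2 hF hg3

/-! ### Finite rank: maps with controlled fibre sizes -/

theorem Fin.exists_map_ncard_fibre {n k a b : ℕ} (hk : 0 < k) (h1 : k * a ≤ n) (h2 : n ≤ k * b) :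
    ∃ f : Fin n → Fin k, ∀ y, a ≤ (f ⁻¹' {y}).ncard ∧ (f ⁻¹' {y}).ncard ≤ b := by
  refine ⟨fun x => ⟨x % k, Nat.mod_lt _ hk⟩, fun y => ?_⟩
  have hcard : ((fun x : Fin n => (⟨x % k, Nat.mod_lt _ hk⟩ : Fin k)) ⁻¹' {y}).ncard =
      n.count (· ≡ y [MOD k]) := by
    rw [Nat.count_eq_card_filter_range, ← Set.ncard_coe_finset,
      ← Set.ncard_image_of_injective _ Fin.val_injective]
    congr 1
    ext m
    simp only [Set.mem_image, Set.mem_preimage, Set.mem_singleton_iff, Fin.ext_iff,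
      Finset.coe_filter, Finset.mem_range, Set.mem_ofPred_eq, Nat.ModEq, Nat.mod_eq_of_lt y.2]
    constructor
    · rintro ⟨x, hx, rfl⟩; exact ⟨x.2, hx⟩
    · rintro ⟨hm, h⟩; exact ⟨⟨m, hm⟩, h, rfl⟩
  rw [hcard, Nat.count_modEq_card _ hk]
  have h3 : a ≤ n / k := (Nat.le_div_iff_mul_le hk).2 (by linarith [mul_comm a k])
  have h4 := Nat.div_add_mod n k
  split_ifs with h
  · refine ⟨by omega, ?_⟩
    by_contra! hcon
    have : b ≤ n / k := by omega
    have := Nat.mul_le_mul_left k this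
    omega
  · refine ⟨by omega, ?_⟩
    rw [add_zero]
    exact Nat.le_of_mul_le_mul_left (by omega : k * (n / k) ≤ k * b) hk

/-- Over each `w`, `n` points are distributed evenly among `k` points with `a' ≤ k ≤ b'`; the two
inequalities give `k * a ≤ n ≤ k * b` whatever `k` is. -/
theorem exists_lift_of_ncard_fibre {X Y W : Type*} (π : X → W) (h : Y → W) {n a b a' b' : ℕ}
    (hπ : ∀ w, (π ⁻¹' {w}).ncard = n)
    (hh : ∀ w, a' ≤ (h ⁻¹' {w}).ncard ∧ (h ⁻¹' {w}).ncard ≤ b') (ha : 1 ≤ a) (ha' : 1 ≤ a')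
    (h1 : b' * a ≤ n) (h2 : n ≤ a' * b) {x₀ : X} {y₀ : Y} (h₀ : π x₀ = h y₀) :
    ∃ f : X → Y, (∀ x, h (f x) = π x) ∧
      (∀ y, a ≤ (f ⁻¹' {y}).ncard ∧ (f ⁻¹' {y}).ncard ≤ b) ∧ f x₀ = y₀ := by
  classical
  have key : ∀ w, ∃ f : X → Y, (∀ x, π x = w → h (f x) = w) ∧
      ∀ y, h y = w → a ≤ {x | π x = w ∧ f x = y}.ncard ∧ {x | π x = w ∧ f x = y}.ncard ≤ b := by
    intro w
    obtain ⟨hw1, hw2⟩ := hh w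
    have hk : 0 < (h ⁻¹' {w}).ncard := by omega
    have hn : 0 < n := by
      have : 1 * 1 ≤ b' * a := Nat.mul_le_mul (by omega) ha
      omega
    have : Finite (h ⁻¹' {w}) := Set.finite_of_ncard_pos hk
    have : Finite (π ⁻¹' {w}) := Set.finite_of_ncard_pos (by rw [hπ]; exact hn)
    obtain ⟨f₀, hf₀⟩ := Fin.exists_map_ncard_fibre hk
      ((Nat.mul_le_mul_right a hw2).trans h1) (h2.trans (Nat.mul_le_mul_right b hw1))
    let eX : {x // π x = w} ≃ Fin n := (Finite.equivFin (π ⁻¹' {w})).trans (finCongr (hπ w))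
    let eY : {y // h y = w} ≃ Fin (h ⁻¹' {w}).ncard := Finite.equivFin (h ⁻¹' {w})
    refine ⟨fun x => if hx : π x = w then eY.symm (f₀ (eX ⟨x, hx⟩)) else y₀, ?_, ?_⟩
    · intro x hx
      simp only [hx, dif_pos]
      exact (eY.symm _).2
    · intro y hy
      have : {x | π x = w ∧ (if hx : π x = w then (eY.symm (f₀ (eX ⟨x, hx⟩)) : Y) else y₀) = y} =
          (fun m => (eX.symm m : X)) '' (f₀ ⁻¹' {eY ⟨y, hy⟩}) := by
        ext x
        constructor
        · rintro ⟨hx, hxy⟩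
          rw [dif_pos hx] at hxy
          refine ⟨eX ⟨x, hx⟩, ?_, by simp⟩
          rw [Set.mem_preimage, Set.mem_singleton_iff, ← eY.symm_apply_eq]
          exact Subtype.ext hxy
        · rintro ⟨m, hm, rfl⟩
          have hx : π (eX.symm m : X) = w := (eX.symm m).2
          refine ⟨hx, ?_⟩
          rw [dif_pos hx]
          have : eX ⟨(eX.symm m : X), hx⟩ = m := by simp
          rw [this, show f₀ m = eY ⟨y, hy⟩ from hm]
          simp
      have hinj : Function.Injective fun m => (eX.symm m : X) :=
        Subtype.val_injective.comp eX.symm.injective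
      rw [this, Set.ncard_image_of_injective _ hinj]
      exact hf₀ _
  choose f hf hfib using key
  -- A swap within one fibre of `h` sends `x₀` to `y₀` without changing the bounds.
  let σ : Equiv.Perm Y := Equiv.swap (f (π x₀) x₀) y₀
  have hσ : ∀ y, h (σ y) = h y := by
    intro y
    have h3 : h (f (π x₀) x₀) = h y₀ := (hf _ _ rfl).trans h₀
    by_cases hy1 : y = f (π x₀) x₀
    · rw [hy1, Equiv.swap_apply_left, h3]
    · by_cases hy2 : y = y₀
      · rw [hy2, Equiv.swap_apply_right, h3]
      · rw [Equiv.swap_apply_of_ne_of_ne hy1 hy2]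
  refine ⟨fun x => σ (f (π x) x), fun x => by rw [hσ, hf _ _ rfl], fun y => ?_,
    Equiv.swap_apply_left _ _⟩
  have : (fun x => σ (f (π x) x)) ⁻¹' {y} = {x | π x = h y ∧ f (h y) x = σ y} := by
    ext x
    have hss : σ (σ y) = y := Equiv.swap_apply_self _ _ _
    simp only [Set.mem_preimage, Set.mem_singleton_iff, Set.mem_ofPred_eq]
    constructor
    · intro hx
      have h3 : f (π x) x = σ y := σ.injective (hx.trans hss.symm)
      have h4 : π x = h y := by rw [← hf _ x rfl, h3, hσ]
      exact ⟨h4, by rw [← h4, h3]⟩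
    · rintro ⟨hx1, hx2⟩
      rw [hx1, hx2, hss]
  rw [this]
  exact hfib _ _ (hσ y)

theorem exists_map_ncard_fibre_of_infinite {X Y : Type*} [Countable X] [Infinite X] [Countable Y]
    [Infinite Y] {a : ℕ} (ha : 0 < a) (x₀ : X) (y₀ : Y) :
    ∃ f : X → Y, (∀ y, (f ⁻¹' {y}).ncard = a) ∧ f x₀ = y₀ := by
  classical
  have : Nonempty (Fin a) := ⟨⟨0, ha⟩⟩
  obtain ⟨e⟩ := nonempty_equiv_of_countable (α := X) (β := Y × Fin a)
  let σ : Equiv.Perm Y := Equiv.swap (e x₀).1 y₀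
  refine ⟨fun x => σ (e x).1, fun y => ?_, Equiv.swap_apply_left _ _⟩
  have : (fun x => σ (e x).1) ⁻¹' {y} =
      (fun k : Fin a => e.symm (σ.symm y, k)) '' Set.univ := by
    ext x
    simp only [Set.mem_preimage, Set.mem_singleton_iff, Set.image_univ, Set.mem_range]
    constructor
    · intro h
      exact ⟨(e x).2, by rw [e.symm_apply_eq, ← h]; simp⟩
    · rintro ⟨k, rfl⟩
      simp
  rw [this, Set.ncard_image_of_injective, Set.ncard_univ, Nat.card_fin]
  intro k k' h
  simpa using h

namespace Subgroup
variable {G : Type*} [Group G]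

theorem ncard_fibre_quotientMapOfLE {K L : Subgroup G} (h : K ≤ L) (w : G ⧸ L) :
    (quotientMapOfLE h ⁻¹' {w}).ncard = K.relIndex L := by
  let e := quotientEquivProdOfLE h
  have he : ∀ x, (e x).1 = quotientMapOfLE h x := fun x => rfl
  have : quotientMapOfLE h ⁻¹' {w} = (fun q => e.symm (w, q)) '' Set.univ := by
    ext x
    simp only [Set.mem_preimage, Set.mem_singleton_iff, Set.image_univ, Set.mem_range]
    constructor
    · intro hx
      exact ⟨(e x).2, by rw [e.symm_apply_eq, ← hx, ← he]⟩
    · rintro ⟨q, rfl⟩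
      rw [← he, e.apply_symm_apply]
  rw [this, Set.ncard_image_of_injective, Set.ncard_univ]
  · rfl
  · intro q q' h
    simpa using h

/-- No `K s'` is all of `G`, so a later one is strictly larger, and each strict enlargement at least
doubles the finite index. -/
theorem exists_le_relIndex {K : ℕ → Subgroup G} (hmono : Monotone K) (hex : ∀ g, ∃ i, g ∈ K i)
    (hfg : ∀ i, (K i).FG) (hG : ¬ Group.FG G)
    (hfin : ∀ i j, i ≤ j → (K i).relIndex (K j) ≠ 0) (s m : ℕ) :
    ∃ s', s < s' ∧ m ≤ (K s).relIndex (K s') := by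
  induction m with
  | zero => exact ⟨s + 1, Nat.lt_succ_self s, Nat.zero_le _⟩
  | succ m ih =>
    obtain ⟨s', hs', hm⟩ := ih
    have hne : ∃ g, g ∉ K s' := by
      by_contra! hcon
      apply hG
      rw [Group.fg_def, ← (Subgroup.eq_top_iff' _).2 hcon]
      exact hfg s'
    obtain ⟨g, hg⟩ := hne
    obtain ⟨i, hi⟩ := hex g
    have hle : s' ≤ max s' i := le_max_left _ _
    refine ⟨max s' i, hs'.trans_le hle, ?_⟩
    rw [← relIndex_mul_relIndex _ _ _ (hmono hs'.le) (hmono hle)]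
    have h1 := hfin s s' hs'.le
    have h2 := hfin s' _ hle
    have h3 : (K s').relIndex (K (max s' i)) ≠ 1 := fun h =>
      hg (relIndex_eq_one.1 h (hmono (le_max_right _ _) hi))
    have h4 : 2 ≤ (K s').relIndex (K (max s' i)) := by omega
    have := Nat.mul_le_mul_left ((K s).relIndex (K s')) h4
    omega

end Subgroup

/-- Take `a'` and `b'` to be `p / b` rounded up and `p / a` rounded down. Since `p / a - p / b` is
at least `3`, rounding leaves `a' < b'`, so the choice can be iterated. -/
theorem Nat.exists_next_fibre_range {a b p : ℕ} (ha : 1 ≤ a) (hab : a < b) (hp : 3 * (a * b) ≤ p) :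
    ∃ a' b', 1 ≤ a' ∧ a' < b' ∧ b' * a ≤ p ∧ p ≤ a' * b := by
  have hb : 0 < b := by omega
  have hpos : 0 < a * b := by positivity
  have h1 : p ≤ (p + b - 1) / b * b := by
    have := Nat.lt_div_mul_add (a := p + b - 1) hb
    omega
  have h2 : (p + b - 1) / b * b ≤ p + b - 1 := Nat.div_mul_le_self _ _
  have h3 : p < p / a * a + a := Nat.lt_div_mul_add ha
  refine ⟨(p + b - 1) / b, p / a, (Nat.le_div_iff_mul_le hb).2 (by omega), ?_,
    Nat.div_mul_le_self _ _, h1⟩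
  by_contra! hcon
  set a' := (p + b - 1) / b
  have h4 : p < a' * a + a := h3.trans_le (Nat.add_le_add_right (Nat.mul_le_mul_right a hcon) a)
  have h5 : p * b < (a' * b) * a + a * b := by nlinarith
  have h6 : (a' * b) * a ≤ (p + b) * a := Nat.mul_le_mul_right a (by omega)
  have h7 : p * (a + 1) ≤ p * b := Nat.mul_le_mul_left p hab
  nlinarith

/-- Subsequences of two towers with unbounded indices, together with ranges for the fibre
cardinalities of interleaving maps between them. -/
theorem exists_fibre_ranges {p q : ℕ → ℕ → ℕ} (hp : ∀ s m, ∃ s', s < s' ∧ m ≤ p s s')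
    (hq : ∀ s m, ∃ s', s < s' ∧ m ≤ q s s') :
    ∃ s t a b a' b' : ℕ → ℕ, StrictMono s ∧ StrictMono t ∧ (∀ i, 1 ≤ a i ∧ 1 ≤ a' i ∧ a i ≤ b i) ∧
      ∀ i, b' i * a i ≤ p (s i) (s (i + 1)) ∧ p (s i) (s (i + 1)) ≤ a' i * b i ∧
        b (i + 1) * a' i ≤ q (t i) (t (i + 1)) ∧ q (t i) (t (i + 1)) ≤ a (i + 1) * b' i := by
  let St := {v : ℕ × ℕ × ℕ × ℕ // 1 ≤ v.2.2.1 ∧ v.2.2.1 < v.2.2.2}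
  have step : ∀ v : St, ∃ (w : St) (a' b' : ℕ), v.1.1 < w.1.1 ∧ v.1.2.1 < w.1.2.1 ∧ 1 ≤ a' ∧
      b' * v.1.2.2.1 ≤ p v.1.1 w.1.1 ∧ p v.1.1 w.1.1 ≤ a' * v.1.2.2.2 ∧
      w.1.2.2.2 * a' ≤ q v.1.2.1 w.1.2.1 ∧ q v.1.2.1 w.1.2.1 ≤ w.1.2.2.1 * b' := by
    rintro ⟨⟨s, t, a, b⟩, ha, hab⟩
    obtain ⟨s', hs, hps⟩ := hp s (3 * (a * b))
    obtain ⟨a', b', ha', hab', h1, h2⟩ := Nat.exists_next_fibre_range ha hab hps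
    obtain ⟨t', ht, hqt⟩ := hq t (3 * (a' * b'))
    obtain ⟨a'', b'', ha'', hab'', h3, h4⟩ := Nat.exists_next_fibre_range ha' hab' hqt
    exact ⟨⟨(s', t', a'', b''), ha'', hab''⟩, a', b', hs, ht, ha', h1, h2, h3, h4⟩
  choose next a' b' h using step
  -- The ranges are chosen upwards from `(1, 2)`, independently of the level from which the maps are
  -- later built downwards.
  let v : ℕ → St := fun i => Nat.rec ⟨(0, 0, 1, 2), by simp⟩ (fun _ w => next w) i
  have hv : ∀ i, v (i + 1) = next (v i) := fun _ => rfl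
  refine ⟨fun i => (v i).1.1, fun i => (v i).1.2.1, fun i => (v i).1.2.2.1,
    fun i => (v i).1.2.2.2, fun i => a' (v i), fun i => b' (v i),
    strictMono_nat_of_lt_succ fun i => ?_, strictMono_nat_of_lt_succ fun i => ?_, fun i => ?_,
    fun i => ?_⟩
  · rw [hv]; exact (h (v i)).1
  · rw [hv]; exact (h (v i)).2.1
  · exact ⟨(v i).2.1, (h (v i)).2.2.1, (v i).2.2.le⟩
  · simp only [hv]
    exact (h (v i)).2.2.2

/-! ### Interleaving two towers of subgroups -/

section Interleaving
variable {G H : Type*} [Group G] [Group H] {K : ℕ → Subgroup G} {L : ℕ → Subgroup H}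

/-- The map `f` respects the towers `K` and `L` up to level `N`, with a shift by one level in the
backward direction. -/
def InterleavedUpTo (K : ℕ → Subgroup G) (L : ℕ → Subgroup H) (i N : ℕ)
    (f : G ⧸ K i → H ⧸ L i) : Prop :=
  ∀ t, i ≤ t → t ≤ N → ∀ (x x' : G) (y y' : H), f x = y → f x' = y' →
    (x⁻¹ * x' ∈ K t → y⁻¹ * y' ∈ L t) ∧ (t < N → y⁻¹ * y' ∈ L t → x⁻¹ * x' ∈ K (t + 1))

theorem InterleavedUpTo.refl (i : ℕ) (f : G ⧸ K i → H ⧸ L i) : InterleavedUpTo K L i i f := by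
  intro t h1 h2 x x' y y' hx hx'
  obtain rfl : t = i := le_antisymm h2 h1
  refine ⟨fun h => ?_, fun h => absurd h (lt_irrefl _)⟩
  rw [← QuotientGroup.eq, ← hx, ← hx', QuotientGroup.eq.2 h]

theorem InterleavedUpTo.step {hK : Monotone K} {hL : Monotone L} {i N : ℕ}
    {f' : G ⧸ K (i + 1) → H ⧸ L (i + 1)} (h : InterleavedUpTo K L (i + 1) N f')
    {g : H ⧸ L i → G ⧸ K (i + 1)} {f : G ⧸ K i → H ⧸ L i}
    (hg : ∀ y, f' (g y) = Subgroup.quotientMapOfLE (hL i.le_succ) y)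
    (hf : ∀ x, g (f x) = Subgroup.quotientMapOfLE (hK i.le_succ) x) :
    InterleavedUpTo K L i N f := by
  intro t h1 h2 x x' y y' hx hx'
  have hgy : ∀ (x : G) (y : H), f x = y → g (y : H ⧸ L i) = (x : G ⧸ K (i + 1)) := by
    intro x y hxy
    rw [← hxy, hf, Subgroup.quotientMapOfLE_apply_mk]
  rcases h1.eq_or_lt with rfl | h1
  · refine ⟨fun h => ?_, fun _ h => ?_⟩
    · rw [← QuotientGroup.eq, ← hx, ← hx', QuotientGroup.eq.2 h]
    · rw [← QuotientGroup.eq, ← hgy x y hx, ← hgy x' y' hx', QuotientGroup.eq.2 h]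
  · have hf' : ∀ (x : G) (y : H), f x = y → f' (x : G ⧸ K (i + 1)) = (y : H ⧸ L (i + 1)) := by
      intro x y hxy
      rw [← hgy x y hxy, hg, Subgroup.quotientMapOfLE_apply_mk]
    exact h t h1 h2 x x' y y' (hf' x y hx) (hf' x' y' hx')

/-- Descending induction from level `N`: lift the quotient map of `H ⧸ L i` through the map at level
`i + 1` to get `g`, then the quotient map of `G ⧸ K i` through `g`. The fibre ranges are what makes
each lift possible. -/
theorem exists_interleavedUpTo [Countable G] [Countable H] (hK : Monotone K) (hL : Monotone L)
    (hKi : ∀ i, Infinite (G ⧸ K i)) (hLi : ∀ i, Infinite (H ⧸ L i)) {a b a' b' : ℕ → ℕ}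
    (ha : ∀ i, 1 ≤ a i ∧ 1 ≤ a' i ∧ a i ≤ b i)
    (hab : ∀ i, b' i * a i ≤ (K i).relIndex (K (i + 1)) ∧
      (K i).relIndex (K (i + 1)) ≤ a' i * b i ∧
      b (i + 1) * a' i ≤ (L i).relIndex (L (i + 1)) ∧
      (L i).relIndex (L (i + 1)) ≤ a (i + 1) * b' i) (N : ℕ) :
    ∀ k i, i + k = N → ∃ f : G ⧸ K i → H ⧸ L i, InterleavedUpTo K L i N f ∧
      (∀ y, a i ≤ (f ⁻¹' {y}).ncard ∧ (f ⁻¹' {y}).ncard ≤ b i) ∧ f (1 : G) = (1 : H) := by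
  intro k
  induction k with
  | zero =>
    rintro i rfl
    have := hKi i
    have := hLi i
    have : Countable (G ⧸ K i) := QuotientGroup.mk_surjective.countable
    have : Countable (H ⧸ L i) := QuotientGroup.mk_surjective.countable
    -- At the top level no coset relation is imposed beyond equality, so any map between the
    -- countably infinite quotients with fibres of size `a i` will do.
    obtain ⟨f, hf, hf1⟩ := exists_map_ncard_fibre_of_infinite (ha i).1
      ((1 : G) : G ⧸ K i) ((1 : H) : H ⧸ L i)
    exact ⟨f, InterleavedUpTo.refl i f, fun y => by rw [hf]; exact ⟨le_rfl, (ha i).2.2⟩, hf1⟩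
  | succ k ih =>
    intro i hi
    obtain ⟨f', hint, hfib, hf'1⟩ := ih (i + 1) (by omega)
    obtain ⟨h1, h2, h3, h4⟩ := hab i
    obtain ⟨g, hg, hgfib, hg1⟩ := exists_lift_of_ncard_fibre
      (Subgroup.quotientMapOfLE (hL i.le_succ)) f' (Subgroup.ncard_fibre_quotientMapOfLE _)
      hfib (ha i).2.1 (ha (i + 1)).1 h3 h4
      (x₀ := ((1 : H) : H ⧸ L i)) (y₀ := ((1 : G) : G ⧸ K (i + 1))) (by
        rw [hf'1, Subgroup.quotientMapOfLE_apply_mk])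
    obtain ⟨f, hf, hffib, hf1⟩ := exists_lift_of_ncard_fibre
      (Subgroup.quotientMapOfLE (hK i.le_succ)) g (Subgroup.ncard_fibre_quotientMapOfLE _)
      hgfib (ha i).1 (ha i).2.1 h1 h2
      (x₀ := ((1 : G) : G ⧸ K i)) (y₀ := ((1 : H) : H ⧸ L i)) (by
        rw [hg1, Subgroup.quotientMapOfLE_apply_mk])
    exact ⟨f, InterleavedUpTo.step (hK := hK) (hL := hL) hint hg hf, hffib, hf1⟩

theorem Subgroup.finite_image_mk {K : ℕ → Subgroup G} (hK : Monotone K)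
    (hfin : ∀ i j, i ≤ j → (K i).relIndex (K j) ≠ 0) (i : ℕ) :
    ((fun x : G => (x : G ⧸ K 0)) '' K i).Finite := by
  have h := Set.finite_of_ncard_ne_zero ((ncard_fibre_quotientMapOfLE (hK (Nat.zero_le i))
    ((1 : G) : G ⧸ K i)).trans_ne (hfin 0 i (Nat.zero_le i)))
  refine h.subset ?_
  rintro _ ⟨x, hx, rfl⟩
  rw [Set.mem_preimage, Subgroup.quotientMapOfLE_apply_mk, Set.mem_singleton_iff]
  exact (QuotientGroup.eq.2 (by simpa using hx)).symm

open Filter in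
-- A compactness argument. Since `1` goes to `1`, the images of a point of `K i` stay in the finite
-- set of cosets of `L 0` in `L i` once `N ≥ i`, so an ultrafilter limit exists. Surjectivity
-- survives since preimages of a point of `L i` stay in the finitely many cosets of `K 0` in `K (i +
-- 1)`.
theorem exists_interleaved_of_forall_upTo (hK : Monotone K) (hL : Monotone L)
    (hKex : ∀ g, ∃ i, g ∈ K i) (hLex : ∀ g, ∃ i, g ∈ L i)
    (hKfin : ∀ i j, i ≤ j → (K i).relIndex (K j) ≠ 0)
    (hLfin : ∀ i j, i ≤ j → (L i).relIndex (L j) ≠ 0)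
    (hf : ∀ N, ∃ f : G ⧸ K 0 → H ⧸ L 0, InterleavedUpTo K L 0 N f ∧
      Function.Surjective f ∧ f (1 : G) = (1 : H)) :
    ∃ f : G → H, (∀ t x x', x⁻¹ * x' ∈ K t → (f x)⁻¹ * f x' ∈ L t) ∧
      (∀ t x x', (f x)⁻¹ * f x' ∈ L t → x⁻¹ * x' ∈ K (t + 1)) ∧
      ∀ y, ∃ x, (f x)⁻¹ * y ∈ L 0 := by
  choose f hint hsurj hf1 using hf
  have hlim : ∀ x : G, ∃ y : H, ∀ᶠ N in (hyperfilter ℕ : Filter ℕ), f N x = (y : H ⧸ L 0) := by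
    intro x
    obtain ⟨i, hi⟩ := hKex x
    have hev : ∀ᶠ N in (hyperfilter ℕ : Filter ℕ),
        ∃ w ∈ (fun y : H => (y : H ⧸ L 0)) '' L i, f N x = w := by
      refine Nat.hyperfilter_le_atTop ((eventually_ge_atTop i).mono fun N hN => ⟨_, ?_, rfl⟩)
      obtain ⟨y, hy⟩ := QuotientGroup.mk_surjective (f N x)
      refine ⟨y, ?_, hy⟩
      have := (hint N i (Nat.zero_le i) hN 1 x 1 y (hf1 N) hy.symm).1 (by simpa using hi)
      simpa using this
    obtain ⟨w, ⟨y, -, rfl⟩, h⟩ := (Ultrafilter.eventually_exists_mem_iff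
      (Subgroup.finite_image_mk hL hLfin i)).1 hev
    exact ⟨y, h⟩
  choose φ hφ using hlim
  have hlarge : ∀ t, ∀ᶠ N in (hyperfilter ℕ : Filter ℕ), t < N := fun t =>
    Nat.hyperfilter_le_atTop (eventually_gt_atTop t)
  refine ⟨φ, fun t x x' h => ?_, fun t x x' h => ?_, fun y => ?_⟩
  · obtain ⟨N, hx, hx', hN⟩ := ((hφ x).and ((hφ x').and (hlarge t))).exists
    exact (hint N t (Nat.zero_le t) hN.le x x' _ _ hx hx').1 h
  · obtain ⟨N, hx, hx', hN⟩ := ((hφ x).and ((hφ x').and (hlarge t))).exists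
    exact (hint N t (Nat.zero_le t) hN.le x x' _ _ hx hx').2 hN h
  · obtain ⟨i, hi⟩ := hLex y
    have hev : ∀ᶠ N in (hyperfilter ℕ : Filter ℕ),
        ∃ w ∈ (fun x : G => (x : G ⧸ K 0)) '' K (i + 1), f N w = (y : H ⧸ L 0) := by
      refine (hlarge i).mono fun N hN => ?_
      obtain ⟨w, hw⟩ := hsurj N (y : H ⧸ L 0)
      obtain ⟨x, rfl⟩ := QuotientGroup.mk_surjective w
      refine ⟨_, ⟨x, ?_, rfl⟩, hw⟩
      have := (hint N i (Nat.zero_le i) hN.le 1 x 1 y (hf1 N) hw).2 hN (by simpa using hi)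
      simpa using this
    obtain ⟨w, ⟨x, -, rfl⟩, h⟩ := (Ultrafilter.eventually_exists_mem_iff
      (Subgroup.finite_image_mk hK hKfin (i + 1))).1 hev
    obtain ⟨N, hx, hx'⟩ := ((hφ x).and h).exists
    refine ⟨x, QuotientGroup.eq.1 (hx.symm.trans hx')⟩

end Interleaving

/-! ### Finite rank: from interleaved towers to coarse equivalence -/

namespace RatCoords

/-- Since `K` has full rank, every coset in `K'` has a representative with all coordinates at most
`1`, and `K'` has finitely many such elements. -/
theorem relIndex_ne_zero {G : Type*} [Group G] {n : ℕ} (c : RatCoords G (Fin n))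
    {K K' : Subgroup G} (hz : ∀ j, c.z j ∈ K) (hK' : K'.FG) (hle : K ≤ K') :
    K.relIndex K' ≠ 0 := by
  obtain ⟨r, hr, -, -, hr1⟩ := c.exists_representatives (K := K) Finset.univ fun j _ => hz j
  have hfin : Finite {k | k ∈ K' ∧ (∀ i ∈ Finset.univ, |c.φ k i| ≤ 1) ∧
    ∀ i ∉ Finset.univ, c.φ k i = 0} := c.finite_bounded hK' Finset.univ 1
  have : Finite (K' ⧸ K.subgroupOf K') := by
    refine Finite.of_surjective (fun k : {k | k ∈ K' ∧ (∀ i ∈ Finset.univ, |c.φ k i| ≤ 1) ∧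
      ∀ i ∉ Finset.univ, c.φ k i = 0} => ((⟨k, k.2.1⟩ : K') : K' ⧸ K.subgroupOf K')) ?_
    intro q
    obtain ⟨x, rfl⟩ := QuotientGroup.mk_surjective q
    have hrx : r x ∈ K' := by
      have := K'.mul_mem x.2 (K'.inv_mem (hle (hr x)))
      simpa using this
    refine ⟨⟨r x, hrx, hr1 _, fun i hi => absurd (Finset.mem_univ i) hi⟩, ?_⟩
    refine QuotientGroup.eq.2 ?_
    rw [Subgroup.mem_subgroupOf]
    exact hr x
  exact Subgroup.index_ne_zero_of_finite

theorem exists_full_rank_tower {G : Type*} [Group G] [Countable G] {n : ℕ}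
    (c : RatCoords G (Fin n)) :
    ∃ K : ℕ → Subgroup G, Monotone K ∧ (∀ g, ∃ i, g ∈ K i) ∧ (∀ i, (K i).FG) ∧
      ∀ i j, c.z j ∈ K i := by
  obtain ⟨g, hg⟩ := exists_surjective_nat G
  refine ⟨fun i => Subgroup.closure (Set.range c.z ∪ g '' Set.Iio i), fun i j h => ?_, fun x => ?_,
    fun i => ?_, fun i j => Subgroup.subset_closure (Or.inl ⟨j, rfl⟩)⟩
  · exact Subgroup.closure_mono
      (Set.union_subset_union_right _ (Set.image_mono (Set.Iio_subset_Iio h)))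
  · obtain ⟨m, rfl⟩ := hg x
    exact ⟨m + 1, Subgroup.subset_closure (Or.inr ⟨m, Nat.lt_succ_self m, rfl⟩)⟩
  · exact (Subgroup.fg_iff _).2 ⟨_, rfl, (Set.finite_range _).union ((Set.finite_Iio i).image _)⟩

theorem exists_near {G : Type*} [Group G] {n : ℕ} (c : RatCoords G (Fin n)) {K : Subgroup G}
    (hz : ∀ j, c.z j ∈ K) (x : G) (v : Fin n → ℚ) :
    ∃ x', x⁻¹ * x' ∈ K ∧ ∀ j, |c.φ x' j - v j| ≤ 1 := by
  obtain ⟨k, hk, h, -⟩ := c.exists_mem_φ_near Finset.univ (fun j _ => hz j) (v - c.φ x)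
  refine ⟨x * k, by simpa using hk, fun j => ?_⟩
  have := h j (Finset.mem_univ j)
  rw [Pi.sub_apply] at this
  rw [c.φ_mul_apply]
  convert this using 2
  ring

end RatCoords

section
variable {G H : Type*}
    [Group G] [Countable G] [MetricSpace G] [ProperSpace G] [IsIsometricSMul G G]
    [Group H] [Countable H] [MetricSpace H] [ProperSpace H] [IsIsometricSMul H H]

/-- The map `f` controls only cosets. Moving its values within cosets of `L 0` makes the coordinates
of `F x` agree with those of `x` up to `1`, without affecting the tower relations; cosets and
coordinates together control finite sets. -/
theorem coarselyEquivalent_of_interleaved {n : ℕ} (c : RatCoords G (Fin n))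
    (c' : RatCoords H (Fin n)) {K : ℕ → Subgroup G} {L : ℕ → Subgroup H}
    (hK : Monotone K) (hL : Monotone L)
    (hKex : ∀ g, ∃ i, g ∈ K i) (hLex : ∀ g, ∃ i, g ∈ L i) (hKfg : ∀ i, (K i).FG)
    (hLfg : ∀ i, (L i).FG) (hKz : ∀ i j, c.z j ∈ K i) (hLz : ∀ i j, c'.z j ∈ L i)
    {f : G → H} (hf : ∀ t x x', x⁻¹ * x' ∈ K t → (f x)⁻¹ * f x' ∈ L t)
    (hf' : ∀ t x x', (f x)⁻¹ * f x' ∈ L t → x⁻¹ * x' ∈ K (t + 1))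
    (hsurj : ∀ y, ∃ x, (f x)⁻¹ * y ∈ L 0) : CoarselyEquivalent G H := by
  choose F hF1 hF2 using fun x => c'.exists_near (hLz 0) (f x) (c.φ x)
  have hFf : ∀ t x x', (F x)⁻¹ * F x' ∈ L t ↔ (f x)⁻¹ * f x' ∈ L t := by
    intro t x x'
    have h1 := hL (Nat.zero_le t) (hF1 x)
    have h2 := hL (Nat.zero_le t) (hF1 x')
    have e : (f x)⁻¹ * f x' = ((f x)⁻¹ * F x) * ((F x)⁻¹ * F x') * ((f x')⁻¹ * F x')⁻¹ := by group
    rw [e, Subgroup.mul_mem_cancel_right _ ((L t).inv_mem h2), Subgroup.mul_mem_cancel_left _ h1]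
  refine coarselyEquivalent_of_finitely (f := F) ?_ ?_
    (c'.finite_bounded (hLfg 0) Finset.univ 2) ?_
  · intro A hA
    obtain ⟨t, ht⟩ := Subgroup.exists_subset_of_monotone hK hKex hA
    obtain ⟨C, -, hC⟩ := c.exists_abs_φ_le hA Finset.univ
    refine ⟨_, c'.finite_bounded (hLfg t) Finset.univ (C + 2), fun x y hxy =>
      ⟨(hFf t x y).2 (hf t x y (ht hxy)), fun j hj => ?_, fun j hj => by simp at hj⟩⟩
    have h1 := hC _ hxy j hj
    have h2 := hF2 x j
    have h3 := hF2 y j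
    rw [c.φ_inv_mul] at h1
    rw [c'.φ_inv_mul]
    rw [abs_le] at h1 h2 h3 ⊢
    constructor <;> linarith
  · intro A hA
    obtain ⟨t, ht⟩ := Subgroup.exists_subset_of_monotone hL hLex hA
    obtain ⟨C, -, hC⟩ := c'.exists_abs_φ_le hA Finset.univ
    refine ⟨_, c.finite_bounded (hKfg (t + 1)) Finset.univ (C + 2), fun x y hxy =>
      ⟨hf' t x y ((hFf t x y).1 (ht hxy)), fun j hj => ?_, fun j hj => by simp at hj⟩⟩
    have h1 := hC _ hxy j hj
    have h2 := hF2 x j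
    have h3 := hF2 y j
    rw [c'.φ_inv_mul] at h1
    rw [c.φ_inv_mul]
    rw [abs_le] at h1 h2 h3 ⊢
    constructor <;> linarith
  · intro y
    obtain ⟨x, hx⟩ := hsurj y
    -- Move `x` within its coset of `K 0` until its coordinates match those of `y`; its image stays
    -- in the coset of `y`, and the two errors of `1` give the bound `2`.
    obtain ⟨x', hx', hx'2⟩ := c.exists_near (hKz 0) x (c'.φ y)
    refine ⟨x', ?_, fun j _ => ?_, fun j hj => by simp at hj⟩
    · have h1 := (L 0).mul_mem ((L 0).mul_mem ((L 0).inv_mem (hF1 x'))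
        ((L 0).inv_mem (hf 0 x x' hx'))) hx
      simpa [mul_assoc] using h1
    · have h2 := hF2 x' j
      have h3 := hx'2 j
      rw [c'.φ_inv_mul]
      rw [abs_le] at h2 h3 ⊢
      constructor <;> linarith

/-- With constant towers `⊤` the coset conditions are void, so even a constant `f` works: the
coordinate correction does everything. -/
theorem coarselyEquivalent_of_fg {n : ℕ} (c : RatCoords G (Fin n)) (c' : RatCoords H (Fin n))
    (hG : Group.FG G) (hH : Group.FG H) : CoarselyEquivalent G H :=
  coarselyEquivalent_of_interleaved c c' (K := fun _ => ⊤) (L := fun _ => ⊤) monotone_const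
    monotone_const (fun _ => ⟨0, trivial⟩) (fun _ => ⟨0, trivial⟩) (fun _ => Group.fg_def.1 hG)
    (fun _ => Group.fg_def.1 hH) (fun _ _ => trivial) (fun _ _ => trivial) (f := fun _ => 1)
    (fun _ _ _ _ => trivial) (fun _ _ _ _ => trivial) fun _ => ⟨1, trivial⟩

theorem infinite_quotient_of_not_fg {G : Type*} [Group G] {K : ℕ → Subgroup G} (hK : Monotone K)
    (hfin : ∀ s m, ∃ s', s < s' ∧ m ≤ (K s).relIndex (K s')) (i : ℕ) : Infinite (G ⧸ K i) := by
  rw [← not_finite_iff_infinite]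
  intro h
  have h0 : (K i).index ≠ 0 := Subgroup.index_ne_zero_of_finite
  obtain ⟨s', hs, hle⟩ := hfin i ((K i).index + 1)
  have := Nat.le_of_dvd (Nat.pos_of_ne_zero h0) (Subgroup.relIndex_dvd_index_of_le (hK hs.le))
  omega

theorem coarselyEquivalent_of_not_fg {n : ℕ} (c : RatCoords G (Fin n)) (c' : RatCoords H (Fin n))
    (hG : ¬ Group.FG G) (hH : ¬ Group.FG H) : CoarselyEquivalent G H := by
  obtain ⟨K, hK, hKex, hKfg, hKz⟩ := c.exists_full_rank_tower
  obtain ⟨L, hL, hLex, hLfg, hLz⟩ := c'.exists_full_rank_tower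
  have hKfin : ∀ i j, i ≤ j → (K i).relIndex (K j) ≠ 0 := fun i j h =>
    c.relIndex_ne_zero (hKz i) (hKfg j) (hK h)
  have hLfin : ∀ i j, i ≤ j → (L i).relIndex (L j) ≠ 0 := fun i j h =>
    c'.relIndex_ne_zero (hLz i) (hLfg j) (hL h)
  have hKg := Subgroup.exists_le_relIndex hK hKex hKfg hG hKfin
  have hLg := Subgroup.exists_le_relIndex hL hLex hLfg hH hLfin
  obtain ⟨s, t, a, b, a', b', hs, ht, ha, hab⟩ := exists_fibre_ranges hKg hLg
  have hKs : ∀ g, ∃ i, g ∈ K (s i) := fun g => by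
    obtain ⟨i, hi⟩ := hKex g
    exact ⟨i, hK (hs.le_apply) hi⟩
  have hLt : ∀ g, ∃ i, g ∈ L (t i) := fun g => by
    obtain ⟨i, hi⟩ := hLex g
    exact ⟨i, hL (ht.le_apply) hi⟩
  have hKm : Monotone (K ∘ s) := hK.comp hs.monotone
  have hLm : Monotone (L ∘ t) := hL.comp ht.monotone
  obtain ⟨f, h1, h2, h3⟩ := exists_interleaved_of_forall_upTo hKm hLm hKs hLt
    (fun i j h => hKfin _ _ (hs.monotone h)) (fun i j h => hLfin _ _ (ht.monotone h)) fun N => by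
      obtain ⟨f, hint, hfib, hf1⟩ := exists_interleavedUpTo hKm hLm
        (fun i => infinite_quotient_of_not_fg hK hKg (s i))
        (fun i => infinite_quotient_of_not_fg hL hLg (t i)) ha hab N N 0 (Nat.zero_add N)
      refine ⟨f, hint, fun y => ?_, hf1⟩
      have := (ha 0).1.trans (hfib y).1
      exact Set.nonempty_of_ncard_ne_zero (s := f ⁻¹' {y}) (by omega)
  exact coarselyEquivalent_of_interleaved c c' hKm hLm hKs hLt (fun i => hKfg _)
    (fun i => hLfg _) (fun i j => hKz _ j) (fun i j => hLz _ j) h1 h2 h3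
end

/-- `IsIsometricSMul G G` says that the metric of `G` is left-invariant; `ProperSpace G` says that
its closed balls are compact. -/
theorem corollary2 {G : Type*} {H : Type*}
    [Group G] [Countable G] [MetricSpace G] [ProperSpace G] [IsIsometricSMul G G]
    [Group H] [Countable H] [MetricSpace H] [ProperSpace H] [IsIsometricSMul H H]
    (hG : IsLocallyFiniteByAbelian G) (hH : IsLocallyFiniteByAbelian H) :
    CoarselyEquivalent G H ↔
      asdim G = asdim H ∧
        ((Group.FG G ∧ Group.FG H) ∨ (¬ Group.FG G ∧ ¬ Group.FG H)) := by
  constructor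
  · intro h
    refine ⟨h.asdim_eq, ?_⟩
    by_cases hfg : Group.FG G
    · exact Or.inl ⟨hfg, h.fg hfg⟩
    · exact Or.inr ⟨hfg, fun h' => hfg (h.symm.fg h')⟩
  · rintro ⟨hdim, hfg⟩
    rcases hG.exists_ratCoords with ⟨n, ⟨c⟩⟩ | ⟨⟨c⟩⟩ <;>
      rcases hH.exists_ratCoords with ⟨m, ⟨c'⟩⟩ | ⟨⟨c'⟩⟩
    · rw [c.asdim_eq, c'.asdim_eq] at hdim
      obtain rfl : n = m := by exact_mod_cast hdim
      rcases hfg with ⟨h1, h2⟩ | ⟨h1, h2⟩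
      · exact coarselyEquivalent_of_fg c c' h1 h2
      · exact coarselyEquivalent_of_not_fg c c' h1 h2
    · rw [c.asdim_eq, c'.asdim_eq_top] at hdim
      exact absurd hdim (ENat.natCast_ne_top n)
    · rw [c.asdim_eq_top, c'.asdim_eq] at hdim
      exact absurd hdim.symm (ENat.natCast_ne_top m)
    · exact coarselyEquivalent_of_infinite_rank c c'
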